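/- A 3-graph $H$ consists of a finite vertex set $V(H)$ and a set $E(H)$ of 3-element subsets of $V(H)$, called edges. It is 3-partite with classes $V_1, V_2, V_3$ if these sets partition $V(H)$ and every edge contains exactly one vertex of each class. Let $\delta_1(H)$ denote the minimum vertex degree of $H$, that is, the minimum over $v \in V(H)$ of the number of edges of $H$ containing $v$. A perfect matching of $H$ is a set of pairwise disjoint edges of $H$ which together cover $V(H)$. Theorem. There exists a constant $c > 0$ such that for every real $\gamma > 0$ the following holds: if $H$ is a 3-partite 3-graph with exactly $n$ vertices in each class, where $n > c\gamma^{-12}$, and $$\delta_1(H) \ge \left(\frac59 + \gamma\right) n^2,$$ then $H$ contains a perfect matching. -/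

import Mathlib

namespace Hypergraph

/-- `H` is a `k`-graph: it has a finite vertex set and each of its edges is a `k`-set. -/
structure IsKGraph {α : Type*} (H : Hypergraph α) (k : ℕ) : Prop where
  finite_vertexSet : H.vertexSet.Finite
  encard_edge : ∀ e ∈ H.edgeSet, e.encard = k

/-- `P 0, …, P (k - 1)` are partition classes of the `k`-partite hypergraph `H`: they partition the
vertex set, and every edge of `H` meets every class in exactly one vertex. -/
structure IsKPartition {α : Type*} (H : Hypergraph α) {k : ℕ} (P : Fin k → Set α) : Prop where
  iUnion_eq : ⋃ i, P i = H.vertexSet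
  disjoint : ∀ i j, i ≠ j → Disjoint (P i) (P j)
  encard_edge_inter : ∀ e ∈ H.edgeSet, ∀ i, (e ∩ P i).encard = 1

/-- For a set `T` of `l` vertices of a `k`-graph `H`, the degree of `T`: the number of
`(k - l)`-sets `S` of vertices such that `S ∪ T` is an edge of `H`. -/
noncomputable def setDegree {α : Type*} (H : Hypergraph α) (k : ℕ) (T : Set α) : ℕ :=
  {S : Set α | S ⊆ H.vertexSet ∧ S.encard + T.encard = k ∧ S ∪ T ∈ H.edgeSet}.ncard

/-- `T` is a legal `l`-set of vertices: it meets every partition class in at most one vertex. -/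
structure IsLegal {α : Type*} (H : Hypergraph α) {k : ℕ} (P : Fin k → Set α) (l : ℕ)
    (T : Set α) : Prop where
  subset_vertexSet : T ⊆ H.vertexSet
  encard_eq : T.encard = l
  encard_inter_le : ∀ i, (T ∩ P i).encard ≤ 1

/-- The minimum `l`-degree `δ_l(H)` of a `k`-partite `k`-graph `H` with partition classes `P`: the
minimum of the degree of `T` over all legal `l`-sets `T`. -/
noncomputable def minLegalDegree {α : Type*} (H : Hypergraph α) {k : ℕ} (P : Fin k → Set α)
    (l : ℕ) : ℕ :=
  sInf {d : ℕ | ∃ T : Set α, H.IsLegal P l T ∧ H.setDegree k T = d}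

/-- `M` is a matching in `H`: a set of pairwise disjoint edges of `H`. -/
structure IsMatching {α : Type*} (H : Hypergraph α) (M : Set (Set α)) : Prop where
  subset_edgeSet : M ⊆ H.edgeSet
  disjoint : ∀ e ∈ M, ∀ f ∈ M, e ≠ f → Disjoint e f

/-- A matching is perfect if it covers all vertices. -/
structure IsPerfectMatching {α : Type*} (H : Hypergraph α) (M : Set (Set α)) : Prop
    extends H.IsMatching M where
  sUnion_eq : ⋃₀ M = H.vertexSet

end Hypergraph

/-! The argument is absorption plus an almost perfect tiling, with weight functions in place of
random choices. Each class is identified with one type `V` of size n, and edges become tuples `Fin 3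
→ V`.

Absorption: two vertices of one class have at least (2 · 5/9 - 1) n² = n²/9 common link pairs. Hence
for each transversal triple T a positive proportion of all pairs of edges absorb T: their vertices
together with T are covered by three edges. `exists_absorbing` picks disjoint pairs one by one, each
shrinking by a constant factor the sum over T of 2^(-number of absorbers of T). Once this sum is
tiny, every triple has many absorbers, and `IsAbsorbingFamily.tiled_union` swallows any small
balanced remainder.

Tiling: this is where 5/9 is critical. If every link in classes of size m exceeds 5m²/9, then for
any vertex costs some edge costs at most the average (`exists_cheap_edge`). Otherwise, after
subtracting class minima, the link of a free vertex consists of pairs that are too expensive, and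
Samuels' inequality for two independent variables allows at most 5m²/9 of those; the value 5/9 = 1 -
(2/3)² belongs to two means 1/3. Costs measuring the first-order growth of an exponential potential
of the relative degrees then give an edge whose removal harms degrees no more than an average
choice. Iterating keeps all relative degrees above 5/9 until only m₀ vertices per class remain,
which are absorbed. -/

namespace TripartiteMatching

open Finset

/-! ### Samuels' inequality for two independent variables. -/

/-- The extremal two-point inequality behind Samuels' bound for two independent variables. -/
theorem two_point_bound {b c u₀ u₁ p₀ p₁ : ℝ} (hc : 0 ≤ c) (hcb : c ≤ b) (hbc : 2 * b + c ≤ 1)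
    (hu₀ : 1 - b < u₀) (hu₀' : u₀ ≤ 1) (hu₁ : u₁ < 1 - b) (hp₀ : 0 ≤ p₀) (hp : p₀ ≤ p₁)
    (hp₁ : p₁ ≤ 1) (h₀ : p₀ * u₀ ≤ c) (h₁ : 0 ≤ u₁ → p₀ * u₀ + (p₁ - p₀) * u₁ ≤ c) :
    (1 - b - u₁) * p₀ + (u₀ - (1 - b)) * p₁ ≤ 5 / 9 * (u₀ - u₁) := by
  obtain ⟨β, rfl⟩ : ∃ β, b = 1 - β := ⟨1 - b, by ring⟩
  simp only [sub_sub_cancel] at *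
  have hc3 : c ≤ 1 / 3 := by linarith
  have hβ : (1 + c) / 2 ≤ β := by linarith
  have hβ1 : β ≤ 1 - c := by linarith
  have hβc : 2 * c ≤ β := by linarith
  have hβ2 : 4 / 9 ≤ β * (1 - c) := by nlinarith
  have hβpos : 0 < β := by linarith
  -- the quadratic inequality with the threshold `0`
  have quad : ∀ {u v : ℝ}, β ≤ u → u ≤ 1 → 0 ≤ v → v ≤ c →
      (β - v) * (c - v) + (u - β) * (u - v) ≤ 5 / 9 * (u - v) ^ 2 := by
    intro u v h1 h2 h3 h4
    -- convex in `u`: endpoint values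
    have e0 : (β - v) * (c - v) ≤ 5 / 9 * (β - v) ^ 2 := by
      have : c - v ≤ 5 / 9 * (β - v) := by linarith
      nlinarith
    have e1 : (β - v) * (c - v) + (1 - β) * (1 - v) ≤ 5 / 9 * (1 - v) ^ 2 := by
      -- convex in `v`
      have f0 : β * c + (1 - β) ≤ 5 / 9 := by linarith
      have f1 : (1 - β) ≤ 5 / 9 * (1 - c) := by linarith
      nlinarith [mul_nonneg h3 (sub_nonneg.2 h4)]
    have : (β - v) * (c - v) + (u - β) * (u - v) - 5 / 9 * (u - v) ^ 2 ≤ 0 := by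
      rcases eq_or_lt_of_le (h1.trans h2) with h | h
      · have : u = 1 := by linarith
        subst this; linarith
      · have key : (1 - β) * ((β - v) * (c - v) + (u - β) * (u - v) - 5 / 9 * (u - v) ^ 2)
          = (1 - u) * ((β - v) * (c - v) - 5 / 9 * (β - v) ^ 2)
            + (u - β) * ((β - v) * (c - v) + (1 - β) * (1 - v) - 5 / 9 * (1 - v) ^ 2)
            - 4 / 9 * (1 - β) * (1 - u) * (u - β) := by ring
        have k1 : (1 - u) * ((β - v) * (c - v) - 5 / 9 * (β - v) ^ 2) ≤ 0 :=
          mul_nonpos_of_nonneg_of_nonpos (by linarith) (by linarith)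
        have k2 : (u - β) * ((β - v) * (c - v) + (1 - β) * (1 - v) - 5 / 9 * (1 - v) ^ 2) ≤ 0 :=
          mul_nonpos_of_nonneg_of_nonpos (by linarith) (by linarith)
        have k3 : 0 ≤ 4 / 9 * (1 - β) * (1 - u) * (u - β) :=
          mul_nonneg (mul_nonneg (by linarith) (by linarith)) (by linarith)
        by_contra hcon
        have := mul_pos (sub_pos.2 h) (not_le.1 hcon)
        linarith
    linarith
  have hu₀pos : 0 < u₀ := hβpos.trans hu₀
  -- Only needed for u₁ < 0: lowering u₁ below 0 raises the left side at rate p₀ and the right side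
  -- at rate 5/9.
  have hp₀' : p₀ ≤ 1 / 2 := by nlinarith
  -- A linear functional of (p₀, p₁) is bounded on a polygon whose shape depends on u₁: for u₁ < 0
  -- the constraint `h₁` is absent; for 0 ≤ u₁ ≤ c the cap p₁ ≤ 1 matters, with vertex ((c - u₁)/(u₀
  -- - u₁), 1); for u₁ > c the cap follows from `h₁`.
  rcases lt_or_ge u₁ 0 with hneg | hpos
  · have q := quad hu₀.le hu₀' le_rfl hc
    simp only [sub_zero] at q
    have : β * p₀ + (u₀ - β) * p₁ ≤ 5 / 9 * u₀ := by
      have h2 : u₀ * (β * p₀ + (u₀ - β) * p₁) ≤ u₀ * (5 / 9 * u₀) := by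
        nlinarith [mul_le_mul_of_nonneg_left h₀ hβpos.le,
          mul_le_mul_of_nonneg_left hp₁ (mul_nonneg hu₀pos.le (sub_nonneg.2 hu₀.le))]
      exact le_of_mul_le_mul_left h2 hu₀pos
    nlinarith
  · specialize h₁ hpos
    have hd : 0 < u₀ - u₁ := by linarith
    refine le_of_mul_le_mul_left ?_ hd
    rcases le_total u₁ c with h | h
    · have q := quad hu₀.le hu₀' hpos h
      -- `p₀ (u₀ - u₁) ≤ c - p₁ u₁`
      have h2 : p₀ * (u₀ - u₁) ≤ c - p₁ * u₁ := by linarith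
      have h3 := mul_le_mul_of_nonneg_left h2 (sub_nonneg.2 hu₁.le)
      -- coefficient of `p₁`
      rcases le_total 0 ((u₀ - β) * (u₀ - u₁) - (β - u₁) * u₁) with hk | hk
      · have := mul_le_mul_of_nonneg_left hp₁ hk
        nlinarith
      · have h4 := mul_nonneg (neg_nonneg.2 hk) (sub_nonneg.2 hp)
        have h5 := mul_le_mul_of_nonneg_left h2 hd.le
        have h6 : u₀ * ((β - u₁) * p₀ + (u₀ - β) * p₁) ≤ u₀ * (5 / 9 * (u₀ - u₁)) := by
          have h7 : c ≤ 5 / 9 * u₀ := by linarith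
          have h8 := mul_le_mul_of_nonneg_left h7 hd.le
          linear_combination h4 + h5 + h8
        exact mul_le_mul_of_nonneg_left (le_of_mul_le_mul_left h6 hu₀pos) hd.le
    · have hu₁pos : 0 ≤ u₁ := hpos
      rcases eq_or_lt_of_le hpos with h0 | h0
      · have : c = 0 := by linarith
        subst this
        have q := quad hu₀.le hu₀' le_rfl le_rfl
        have : p₀ = 0 := by nlinarith
        subst this
        rw [← h0] at *
        nlinarith
      -- vertices `(c/u₀, c/u₀)` and `(0, c/u₁)`
      have h2 : p₀ * (u₀ - u₁) + p₁ * u₁ ≤ c := by linarith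
      have hA : (u₀ - β) * c ≤ 5 / 9 * u₁ * (u₀ - u₁) := by
        have e1 : (u₀ - β) ≤ 5 / 9 * (u₀ - c) := by linarith
        have e2 : c ≤ 5 / 9 * β := by linarith
        have e3 := mul_nonneg (sub_nonneg.2 hu₁.le) (mul_nonneg hc (sub_nonneg.2 e1))
        have e4 := mul_nonneg (sub_nonneg.2 h) (mul_nonneg (sub_nonneg.2 hu₀.le) (sub_nonneg.2 e2))
        have e5 := mul_nonneg (mul_nonneg (show 0 ≤ β - c by linarith) (sub_nonneg.2 h))
          (sub_nonneg.2 hu₁.le)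
        have e6 : (β - c) * ((u₀ - β) * c) ≤ (β - c) * (5 / 9 * u₁ * (u₀ - u₁)) := by
          linear_combination e3 + e4 + 5 / 9 * e5
        exact le_of_mul_le_mul_left e6 (by linarith)
      have hB : u₁ * ((β - u₁) * p₀ + (u₀ - β) * p₁) ≤ u₁ * (5 / 9 * (u₀ - u₁)) := by
        have h3 := mul_le_mul_of_nonneg_left h2 (sub_nonneg.2 hu₀.le)
        rcases le_total (u₁ * (β - u₁) - (u₀ - β) * (u₀ - u₁)) 0 with hk | hk
        · have h4 := mul_nonneg hp₀ (neg_nonneg.2 hk)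
          linear_combination h3 + h4 + hA
        · have h4 := mul_le_mul_of_nonneg_left h₀ hk
          have h5 : u₀ * (u₁ * ((β - u₁) * p₀ + (u₀ - β) * p₁)) ≤
              u₀ * (u₁ * (5 / 9 * (u₀ - u₁))) := by
            have h6 := mul_le_mul_of_nonneg_left h3 hu₀pos.le
            have h7 : c ≤ 5 / 9 * u₀ := by linarith
            have h8 := mul_le_mul_of_nonneg_right h7 (mul_nonneg hu₁pos hd.le)
            linear_combination h6 + h4 + h8
          exact le_of_mul_le_mul_left h5 hu₀pos
      exact mul_le_mul_of_nonneg_left (le_of_mul_le_mul_left hB h0) hd.le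

/-- A function on a finite set with weights `z` of mean `b` has average at most `K` as soon as all
its two-point averages with mean `b` are at most `K`. -/
theorem sum_le_of_two_point {ι : Type*} (t : Finset ι) (z g : ι → ℝ) (b K : ℝ)
    (hb : ∑ w ∈ t, z w = b * #t) (heq : ∀ w ∈ t, z w = b → g w ≤ K)
    (htwo : ∀ w ∈ t, ∀ w' ∈ t, z w < b → b < z w' →
      (z w' - b) * g w + (b - z w) * g w' ≤ K * (z w' - z w)) :
    ∑ w ∈ t, g w ≤ K * #t := by
  have hb0 : ∑ w ∈ t, (z w - b) = 0 := by
    rw [sum_sub_distrib, hb, sum_const, nsmul_eq_mul]; ring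
  -- a supporting line at `b`
  suffices h : ∃ k : ℝ, ∀ w ∈ t, g w ≤ K + k * (z w - b) by
    obtain ⟨k, hk⟩ := h
    calc ∑ w ∈ t, g w ≤ ∑ w ∈ t, (K + k * (z w - b)) := sum_le_sum hk
      _ = K * #t := by
        rw [sum_add_distrib, ← mul_sum, hb0, sum_const, nsmul_eq_mul]; ring
  by_cases hne : (t.filter fun w => b < z w).Nonempty
  -- The line through (b, K) takes the steepest slope towards a point on the right of b. Points on
  -- the right lie below it by maximality, points on the left by `htwo` applied with w'.
  · obtain ⟨w', hw', hmax⟩ := exists_max_image _ (fun w => (g w - K) / (z w - b)) hne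
    rw [mem_filter] at hw'
    refine ⟨(g w' - K) / (z w' - b), fun w hw => ?_⟩
    have hpos : 0 < z w' - b := sub_pos.2 hw'.2
    rcases lt_trichotomy (z w) b with h | h | h
    · have := htwo w hw w' hw'.1 h hw'.2
      have h2 : (z w' - b) * g w ≤ (z w' - b) * (K + (g w' - K) / (z w' - b) * (z w - b)) := by
        have : (z w' - b) * (K + (g w' - K) / (z w' - b) * (z w - b))
            = (z w' - b) * K + (g w' - K) * (z w - b) := by
          field_simp
        rw [this]; linarith
      exact le_of_mul_le_mul_left h2 hpos
    · rw [h, sub_self, mul_zero, add_zero]; exact heq w hw h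
    · have := hmax w (mem_filter.2 ⟨hw, h⟩)
      have h2 := (div_le_iff₀ (sub_pos.2 h)).1 this
      linarith
  · have hall : ∀ w ∈ t, z w ≤ b := fun w hw => by
      by_contra h
      exact hne ⟨w, mem_filter.2 ⟨hw, not_le.1 h⟩⟩
    have hz := (sum_eq_zero_iff_of_nonpos fun w hw => sub_nonpos.2 (hall w hw)).1 hb0
    refine ⟨0, fun w hw => ?_⟩
    rw [zero_mul, add_zero]
    exact heq w hw (sub_eq_zero.1 (hz w hw))

/-- Samuels' bound for two variables, in the range needed here. -/
theorem card_pairs_le {ι κ : Type*} (s : Finset ι) (t : Finset κ) (y : ι → ℝ) (z : κ → ℝ)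
    {m : ℕ} (hm : 0 < m) (hs : #s = m) (ht : #t = m) {b c : ℝ}
    (hy : ∀ x ∈ s, 0 ≤ y x) (hz : ∀ x ∈ t, 0 ≤ z x)
    (hyc : ∑ x ∈ s, y x = c * m) (hzb : ∑ x ∈ t, z x = b * m) (hcb : c ≤ b)
    (hbc : 2 * b + c ≤ 1) :
    (#((s ×ˢ t).filter fun p => 1 ≤ y p.1 + z p.2) : ℝ) ≤ 5 / 9 * (m : ℝ) ^ 2 := by
  have hm' : (0 : ℝ) < m := by exact_mod_cast hm
  have hc : 0 ≤ c := by
    have := sum_nonneg hy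
    rw [hyc] at this
    exact nonneg_of_mul_nonneg_left this hm'
  set G : ℝ → ℝ := fun u => #(s.filter fun x => u ≤ y x) with hG
  have hcount : (#((s ×ˢ t).filter fun p => 1 ≤ y p.1 + z p.2) : ℝ) = ∑ w ∈ t, G (1 - z w) := by
    rw [card_filter, sum_product_right]
    push_cast
    refine sum_congr rfl fun w _ => ?_
    simp only [hG, card_filter]
    push_cast
    refine sum_congr rfl fun x _ => ?_
    simp only [sub_le_iff_le_add]
  have hG0 : ∀ u, 0 ≤ G u := fun u => Nat.cast_nonneg _
  have hGm : ∀ u, G u ≤ m := fun u => by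
    simp only [hG]; rw [← hs]; exact_mod_cast card_filter_le _ _
  have hGmono : ∀ u v, u ≤ v → G v ≤ G u := fun u v h => by
    simp only [hG]
    exact_mod_cast card_le_card (monotone_filter_right _ fun x _ hx => h.trans hx)
  -- Two-level Markov inequality: y dominates the step function equal to u₀ where y ≥ u₀, to u₁
  -- where u₁ ≤ y < u₀, and to 0 elsewhere.
  have hG2 : ∀ u₁ u₀, 0 ≤ u₁ → u₁ ≤ u₀ → G u₀ * u₀ + (G u₁ - G u₀) * u₁ ≤ c * m := by
    intro u₁ u₀ h0 h
    rw [← hyc]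
    have : G u₀ * u₀ + (G u₁ - G u₀) * u₁
        = ∑ x ∈ s, ((if u₀ ≤ y x then (u₀ - u₁) else 0) + if u₁ ≤ y x then u₁ else 0) := by
      rw [sum_add_distrib, ← sum_filter, ← sum_filter, sum_const, sum_const, nsmul_eq_mul,
        nsmul_eq_mul]
      simp only [hG]; ring
    rw [this]
    refine sum_le_sum fun x hx => ?_
    have := hy x hx
    split_ifs <;> linarith
  have hG1 : ∀ u, 0 ≤ u → G u * u ≤ c * m := fun u h => by
    simpa using hG2 u u h le_rfl
  rw [hcount]
  have := sum_le_of_two_point t z (fun w => G (1 - z w)) b (5 / 9 * m) (by rw [hzb, ht]) ?_ ?_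
  · rw [ht] at this
    linarith
  · intro w hw h
    simp only [h]
    have h1 := hG1 (1 - b) (by linarith)
    have h2 : (1 - b) * G (1 - b) ≤ (1 - b) * (5 / 9 * m) := by nlinarith
    exact le_of_mul_le_mul_left h2 (by linarith)
  · intro w hw w' hw' h h'
    have hzw := hz w hw
    have := two_point_bound (u₀ := 1 - z w) (u₁ := 1 - z w') (p₀ := G (1 - z w) / m)
      (p₁ := G (1 - z w') / m) hc hcb hbc (by linarith) (by linarith) (by linarith)
      (div_nonneg (hG0 _) hm'.le)
      (div_le_div_of_nonneg_right (hGmono _ _ (by linarith)) hm'.le)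
      ((div_le_one hm').2 (hGm _))
      (by rw [div_mul_eq_mul_div, div_le_iff₀ hm']; exact hG1 _ (by linarith))
      (fun h0 => by
        rw [← sub_div, div_mul_eq_mul_div, div_mul_eq_mul_div, ← add_div, div_le_iff₀ hm']
        exact hG2 _ _ h0 (by linarith))
    rw [mul_div_assoc', mul_div_assoc', ← add_div, div_le_iff₀ hm'] at this
    linarith

/-! ### Links of vertices and the existence of cheap edges. -/

section Tuples

variable {V : Type*} [DecidableEq V]

/-- The edges `f` through the vertex `a` of class `i` whose other two vertices lie in `R`. -/
def link (E : Finset (Fin 3 → V)) (R : Fin 3 → Finset V) (i : Fin 3) (a : V) :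
    Finset (Fin 3 → V) :=
  E.filter fun f => f i = a ∧ ∀ j, j ≠ i → f j ∈ R j

theorem mem_link {E : Finset (Fin 3 → V)} {R : Fin 3 → Finset V} {i : Fin 3} {a : V}
    {f : Fin 3 → V} : f ∈ link E R i a ↔ f ∈ E ∧ f i = a ∧ ∀ j, j ≠ i → f j ∈ R j := by
  simp [link]

theorem mem_of_mem_link {E : Finset (Fin 3 → V)} {R : Fin 3 → Finset V} {i : Fin 3} {a : V}
    {f : Fin 3 → V} (ha : a ∈ R i) (hf : f ∈ link E R i a) : ∀ j, f j ∈ R j := by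
  obtain ⟨-, rfl, h⟩ := mem_link.1 hf
  intro j
  by_cases hj : j = i
  · rwa [hj]
  · exact h j hj

theorem exists_sorting (Y : Fin 3 → ℝ) : ∃ i j k : Fin 3, i ≠ j ∧ i ≠ k ∧ j ≠ k ∧
    Y k ≤ Y j ∧ Y j ≤ Y i := by
  have h := Tuple.monotone_sort Y
  refine ⟨Tuple.sort Y 2, Tuple.sort Y 1, Tuple.sort Y 0, ?_, ?_, ?_, h (by decide), h (by decide)⟩
  all_goals exact fun h => absurd ((Tuple.sort Y).injective h) (by decide)

theorem fin3_cases {i j k : Fin 3} (hij : i ≠ j) (hik : i ≠ k) (hjk : j ≠ k) (l : Fin 3) :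
    l = i ∨ l = j ∨ l = k := by
  revert i j k l; decide

theorem fin3_sum {i j k : Fin 3} (hij : i ≠ j) (hik : i ≠ k) (hjk : j ≠ k) (f : Fin 3 → ℝ) :
    ∑ l, f l = f i + f j + f k := by
  have : (univ : Finset (Fin 3)) = {i, j, k} := by
    ext l; simpa using fin3_cases hij hik hjk l
  rw [this, sum_insert (by simp [hij, hik]), sum_pair hjk, add_assoc]

/-- If all degrees exceed `5/9`, then for every cost function some edge costs at most the
average, that is, there is no fractional vertex cover of weight less than `m`. -/
theorem exists_cheap_edge (E : Finset (Fin 3 → V)) (R : Fin 3 → Finset V) {m : ℕ} (hm : 0 < m)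
    (hR : ∀ i, #(R i) = m)
    (hdeg : ∀ i, ∀ a ∈ R i, 5 / 9 * (m : ℝ) ^ 2 < #(link E R i a)) (c : Fin 3 → V → ℝ) :
    ∃ f ∈ E, (∀ i, f i ∈ R i) ∧ m * ∑ i, c i (f i) ≤ ∑ i, ∑ x ∈ R i, c i x := by
  have hm' : (0 : ℝ) < m := by exact_mod_cast hm
  have hmin : ∀ i, ∃ a ∈ R i, ∀ x ∈ R i, c i a ≤ c i x := fun i =>
    exists_min_image _ _ (card_pos.1 (by rw [hR i]; exact hm))
  choose a haR hamin using hmin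
  set y : Fin 3 → V → ℝ := fun i x => c i x - c i (a i) with hy
  set Y : Fin 3 → ℝ := fun i => ∑ x ∈ R i, y i x with hY
  have hy0 : ∀ i, ∀ x ∈ R i, 0 ≤ y i x := fun i x hx => sub_nonneg.2 (hamin i x hx)
  have hY0 : ∀ i, 0 ≤ Y i := fun i => sum_nonneg (hy0 i)
  suffices h : ∃ f ∈ E, (∀ i, f i ∈ R i) ∧ m * ∑ i, y i (f i) ≤ ∑ i, Y i by
    obtain ⟨f, hf, hfR, hle⟩ := h
    refine ⟨f, hf, hfR, ?_⟩
    simp only [hY, hy, sum_sub_distrib, sum_const, hR, nsmul_eq_mul, ← mul_sum] at hle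
    linarith
  by_contra! hcon
  -- The free vertex is taken in the class of largest total cost. The two other normalised means b =
  -- Y j / S and c = Y k / S then satisfy c ≤ b and 2b + c ≤ 1, the range of `card_pairs_le`.
  obtain ⟨i, j, k, hij, hik, hjk, hYkj, hYji⟩ := exists_sorting Y
  have hSsum := fin3_sum hij hik hjk Y
  set S := ∑ l, Y l with hS
  have hYi := hY0 i
  have hYj := hY0 j
  have hYk := hY0 k
  have hlink : ∀ f ∈ link E R i (a i), S < m * (y j (f j) + y k (f k)) := by
    intro f hf
    have := hcon f (mem_link.1 hf).1 (mem_of_mem_link (haR i) hf)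
    rw [fin3_sum hij hik hjk, (mem_link.1 hf).2.1] at this
    have h0 : y i (a i) = 0 := by simp [hy]
    rwa [h0, zero_add] at this
  have hS0 : 0 ≤ S := by linarith
  rcases hS0.eq_or_lt with hS0 | hS0
  · have hpos : 0 < #(link E R i (a i)) := by
      have := hdeg i (a i) (haR i)
      have h2 : (0 : ℝ) < #(link E R i (a i)) := lt_of_le_of_lt (by positivity) this
      exact_mod_cast h2
    obtain ⟨f, hf⟩ := card_pos.1 hpos
    have hfR := mem_of_mem_link (haR i) hf
    have h1 : y j (f j) ≤ Y j := single_le_sum (hy0 j) (hfR j)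
    have h2 : y k (f k) ≤ Y k := single_le_sum (hy0 k) (hfR k)
    have h3 := hlink f hf
    nlinarith [hy0 j _ (hfR j), hy0 k _ (hfR k)]
  · have key := card_pairs_le (R k) (R j) (fun x => m * y k x / S) (fun x => m * y j x / S) hm
      (hR k) (hR j) (b := Y j / S) (c := Y k / S)
      (fun x hx => div_nonneg (mul_nonneg hm'.le (hy0 k x hx)) hS0.le)
      (fun x hx => div_nonneg (mul_nonneg hm'.le (hy0 j x hx)) hS0.le)
      (by simp only [hY]; rw [← sum_div, ← mul_sum]; ring)
      (by simp only [hY]; rw [← sum_div, ← mul_sum]; ring)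
      (div_le_div_of_nonneg_right hYkj hS0.le)
      (by rw [mul_div_assoc', ← add_div, div_le_one hS0]; linarith)
    have hcard : #(link E R i (a i)) ≤
        #((R k ×ˢ R j).filter fun p => 1 ≤ m * y k p.1 / S + m * y j p.2 / S) := by
      refine card_le_card_of_injOn (fun f => (f k, f j)) ?_ ?_
      · intro f hf
        have hf : f ∈ link E R i (a i) := hf
        have hfR := mem_of_mem_link (haR i) hf
        have := hlink f hf
        simp only [coe_filter, mem_product, Set.mem_ofPred_eq]
        refine ⟨⟨hfR k, hfR j⟩, ?_⟩
        rw [← add_div, le_div_iff₀ hS0]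
        linarith
      · intro f hf g hg hfg
        have hf : f ∈ link E R i (a i) := hf
        have hg : g ∈ link E R i (a i) := hg
        simp only [Prod.mk.injEq] at hfg
        funext l
        rcases fin3_cases hij hik hjk l with rfl | rfl | rfl
        · rw [(mem_link.1 hf).2.1, (mem_link.1 hg).2.1]
        · exact hfg.2
        · exact hfg.1
    have := hdeg i (a i) (haR i)
    have h2 : (#(link E R i (a i)) : ℝ) ≤ _ := Nat.cast_le.2 hcard
    linarith

theorem card_link_eq_sum {E : Finset (Fin 3 → V)} {R : Fin 3 → Finset V} {i j : Fin 3} (a : V)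
    (hij : j ≠ i) : #(link E R i a) = ∑ x ∈ R j, #((link E R i a).filter fun f => f j = x) :=
  card_eq_sum_card_fiberwise fun _ hf => (mem_link.1 hf).2.2 j hij

theorem card_filter_link_le {E : Finset (Fin 3 → V)} {R : Fin 3 → Finset V} {m : ℕ}
    (hR : ∀ i, #(R i) ≤ m) {i j : Fin 3} (a x : V) (hij : j ≠ i) :
    #((link E R i a).filter fun f => f j = x) ≤ m := by
  obtain ⟨k, hik, hjk⟩ : ∃ k, i ≠ k ∧ j ≠ k := by revert i j; decide
  refine le_trans (card_le_card_of_injOn (fun f => f k) ?_ ?_) (hR k)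
  · intro f hf
    exact (mem_link.1 (mem_filter.1 hf).1).2.2 k hik.symm
  · intro f hf g hg hfg
    obtain ⟨hf, hfx⟩ := mem_filter.1 (show f ∈ _ from hf)
    obtain ⟨hg, hgx⟩ := mem_filter.1 (show g ∈ _ from hg)
    funext l
    rcases fin3_cases hij.symm hik hjk l with rfl | rfl | rfl
    · rw [(mem_link.1 hf).2.1, (mem_link.1 hg).2.1]
    · rw [hfx, hgx]
    · exact hfg

theorem card_link_le {E : Finset (Fin 3 → V)} {R : Fin 3 → Finset V} {m : ℕ}
    (hR : ∀ i, #(R i) ≤ m) (i : Fin 3) (a : V) : #(link E R i a) ≤ m ^ 2 := by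
  obtain ⟨j, hj⟩ : ∃ j, j ≠ i := by revert i; decide
  rw [card_link_eq_sum a hj, sq]
  calc _ ≤ ∑ x ∈ R j, m := sum_le_sum fun x _ => card_filter_link_le hR a x hj
    _ = #(R j) * m := by rw [sum_const, smul_eq_mul]
    _ ≤ m * m := Nat.mul_le_mul_right _ (hR j)

theorem card_link_le_erase (E : Finset (Fin 3 → V)) (R : Fin 3 → Finset V) (x : Fin 3 → V)
    (i : Fin 3) (a : V) : #(link E R i a) ≤ #(link E (fun j => (R j).erase (x j)) i a) +
      ∑ j ∈ univ.erase i, #((link E R i a).filter fun f => f j = x j) := by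
  have hsub : link E R i a ⊆ link E (fun j => (R j).erase (x j)) i a ∪
      (univ.erase i).biUnion fun j => (link E R i a).filter fun f => f j = x j := by
    intro f hf
    by_cases h : ∃ j, j ≠ i ∧ f j = x j
    · obtain ⟨j, hj, hfj⟩ := h
      exact mem_union_right _ (mem_biUnion.2 ⟨j, by simpa using hj, mem_filter.2 ⟨hf, hfj⟩⟩)
    · push Not at h
      obtain ⟨h1, h2, h3⟩ := mem_link.1 hf
      exact mem_union_left _ (mem_link.2 ⟨h1, h2, fun j hj => mem_erase.2 ⟨h j hj, h3 j hj⟩⟩)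
  refine (card_le_card hsub).trans ((card_union_le _ _).trans ?_)
  exact Nat.add_le_add_left card_biUnion_le _

/-! ### Greedy tiling controlled by an exponential potential. -/

section

variable [Fintype V]

/-- The exponential potential of the relative degrees into `R`, where `R` has class size `m`. -/
noncomputable def potential (E : Finset (Fin 3 → V)) (l : ℝ) (m : ℕ) (R : Fin 3 → Finset V) : ℝ :=
  ∑ i, ∑ a : V, Real.exp (-(l * (#(link E R i a) / (m : ℝ) ^ 2)))

/-- An edge cheap for the first-order loss costs a degree d on weighted average at most 2d/(m+1).
Passing from normalisation (m+1)² to m² makes up for this loss, so only second-order errors survive.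
Their factors exp(O(l²/m²)) have a convergent product along the greedy process. -/
theorem exists_edge_potential_le (E : Finset (Fin 3 → V)) (R : Fin 3 → Finset V) {m : ℕ}
    (hm : 1 ≤ m) (hR : ∀ i, #(R i) = m + 1)
    (hdeg : ∀ i, ∀ a ∈ R i, 5 / 9 * ((m + 1 : ℕ) : ℝ) ^ 2 < #(link E R i a)) {l : ℝ} (hl : 1 ≤ l)
    (hlm : 8 * l ≤ m + 1) :
    ∃ f ∈ E, (∀ i, f i ∈ R i) ∧ potential E l m (fun j => (R j).erase (f j)) ≤
      potential E l (m + 1) R * Real.exp (68 * l ^ 2 / ((m : ℝ) + 1) ^ 2) := by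
  have hm1 : (1 : ℝ) ≤ m := by exact_mod_cast hm
  have hm0 : (0 : ℝ) < m := by linarith
  have hl0 : 0 < l := by linarith
  set W : Fin 3 → V → ℝ := fun i a => Real.exp (-(l * (#(link E R i a) / (m : ℝ) ^ 2))) with hW
  set cod : Fin 3 → V → Fin 3 → V → ℝ :=
    fun i a j x => (#((link E R i a).filter fun f => f j = x) : ℝ) with hcod
  -- The cost of x in class j is the first-order increase of the potential when x is deleted; summed
  -- over x in `R j`, the codegrees add up to degrees.
  obtain ⟨f, hfE, hfR, hcost⟩ := exists_cheap_edge E R (Nat.succ_pos m) hR hdeg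
    (fun j x => ∑ i ∈ univ.erase j, ∑ a, W i a * (l / (m : ℝ) ^ 2 * cod i a j x))
  refine ⟨f, hfE, hfR, ?_⟩
  -- total loss caused by removing `f`
  set D : Fin 3 → V → ℝ := fun i a => ∑ j ∈ univ.erase i, cod i a j (f j) with hD
  have hswap : ∀ F : Fin 3 → Fin 3 → ℝ,
      ∑ j, ∑ i ∈ univ.erase j, F i j = ∑ i, ∑ j ∈ univ.erase i, F i j := by
    intro F
    refine sum_comm' fun x y => ?_
    simp [ne_comm]
  have hL : ∑ j, (∑ i ∈ univ.erase j, ∑ a, W i a * (l / (m : ℝ) ^ 2 * cod i a j (f j)))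
      = ∑ i, ∑ a, W i a * (l / (m : ℝ) ^ 2 * D i a) := by
    rw [hswap fun i j => ∑ a, W i a * (l / (m : ℝ) ^ 2 * cod i a j (f j))]
    refine sum_congr rfl fun i _ => ?_
    rw [sum_comm]
    refine sum_congr rfl fun a _ => ?_
    rw [hD, mul_sum, mul_sum]
  have hRt : ∑ j, ∑ x ∈ R j, (∑ i ∈ univ.erase j, ∑ a, W i a * (l / (m : ℝ) ^ 2 * cod i a j x))
      = ∑ i, ∑ a, W i a * (l / (m : ℝ) ^ 2 * (2 * #(link E R i a))) := by
    have h1 : ∀ j, ∑ x ∈ R j, (∑ i ∈ univ.erase j, ∑ a, W i a * (l / (m : ℝ) ^ 2 * cod i a j x))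
        = ∑ i ∈ univ.erase j, ∑ a, W i a * (l / (m : ℝ) ^ 2 * #(link E R i a)) := by
      intro j
      rw [sum_comm]
      refine sum_congr rfl fun i hi => ?_
      rw [sum_comm]
      refine sum_congr rfl fun a _ => ?_
      rw [← mul_sum, ← mul_sum, card_link_eq_sum a (ne_of_mem_erase hi).symm]
      push_cast; rfl
    simp only [h1]
    rw [hswap fun i _ => ∑ a, W i a * (l / (m : ℝ) ^ 2 * #(link E R i a))]
    refine sum_congr rfl fun i _ => ?_
    rw [sum_const, card_erase_of_mem (mem_univ i), card_univ, Fintype.card_fin, nsmul_eq_mul,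
      mul_sum]
    refine sum_congr rfl fun a _ => ?_
    push_cast; ring
  rw [hL, hRt] at hcost
  have hD0 : ∀ i a, 0 ≤ D i a := fun i a => sum_nonneg fun _ _ => Nat.cast_nonneg _
  have hDm : ∀ i a, D i a ≤ 2 * ((m : ℝ) + 1) := by
    intro i a
    have : D i a ≤ ∑ j ∈ univ.erase i, ((m + 1 : ℕ) : ℝ) := by
      refine sum_le_sum fun j hj => ?_
      exact Nat.cast_le.2 (card_filter_link_le (fun i => (hR i).le) a _ (ne_of_mem_erase hj))
    rw [sum_const, card_erase_of_mem (mem_univ i), card_univ, Fintype.card_fin, nsmul_eq_mul] at this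
    push_cast at this
    linarith
  set u : Fin 3 → V → ℝ := fun i a => l / (m : ℝ) ^ 2 * D i a with hu
  have hu0 : ∀ i a, 0 ≤ u i a := fun i a => mul_nonneg (by positivity) (hD0 i a)
  have hM : 0 < (m : ℝ) + 1 := by linarith
  have hu8 : ∀ i a, u i a ≤ 8 * l / (m + 1) := by
    intro i a
    calc u i a ≤ l / (m : ℝ) ^ 2 * (2 * ((m : ℝ) + 1)) :=
          mul_le_mul_of_nonneg_left (hDm i a) (by positivity)
      _ ≤ 8 * l / (m + 1) := by
        rw [div_mul_eq_mul_div, div_le_div_iff₀ (by positivity) hM]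
        have : ((m : ℝ) + 1) ^ 2 ≤ 4 * (m : ℝ) ^ 2 := by nlinarith
        nlinarith
  have hu1 : ∀ i a, u i a ≤ 1 := fun i a => (hu8 i a).trans ((div_le_one hM).2 hlm)
  -- each term of the new potential
  have hterm : ∀ i a, Real.exp (-(l * (#(link E (fun j => (R j).erase (f j)) i a) / (m : ℝ) ^ 2)))
      ≤ W i a * (1 + u i a + 64 * l ^ 2 / ((m : ℝ) + 1) ^ 2) := by
    intro i a
    have h1 : (#(link E R i a) : ℝ) ≤ #(link E (fun j => (R j).erase (f j)) i a) + D i a := by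
      have := card_link_le_erase E R f i a
      have h2 : (#(link E R i a) : ℝ) ≤ _ := Nat.cast_le.2 this
      push_cast at h2
      exact h2
    have h2 : Real.exp (-(l * (#(link E (fun j => (R j).erase (f j)) i a) / (m : ℝ) ^ 2)))
        ≤ W i a * Real.exp (u i a) := by
      rw [hW, ← Real.exp_add, Real.exp_le_exp, hu]
      have : l / (m : ℝ) ^ 2 * #(link E R i a) ≤
        l / (m : ℝ) ^ 2 * (#(link E (fun j => (R j).erase (f j)) i a) + D i a) :=
          mul_le_mul_of_nonneg_left h1 (by positivity)
      calc _ = -(l / (m : ℝ) ^ 2 * #(link E (fun j => (R j).erase (f j)) i a)) := by ring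
        _ ≤ -(l / (m : ℝ) ^ 2 * #(link E R i a)) + l / (m : ℝ) ^ 2 * D i a := by linarith
        _ = _ := by ring
    refine h2.trans (mul_le_mul_of_nonneg_left ?_ (Real.exp_pos _).le)
    have h3 := (abs_le.1 (Real.abs_exp_sub_one_sub_id_le
      (abs_le.2 ⟨by linarith [hu0 i a], hu1 i a⟩))).2
    have h4 : u i a ^ 2 ≤ (8 * l / (m + 1)) ^ 2 := pow_le_pow_left₀ (hu0 i a) (hu8 i a) 2
    have h5 : (8 * l / ((m : ℝ) + 1)) ^ 2 = 64 * l ^ 2 / ((m : ℝ) + 1) ^ 2 := by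
      rw [div_pow]; ring
    linarith
  -- replace the loss by its average
  have hterm2 : ∀ i a, W i a * (1 + l / (m : ℝ) ^ 2 * (2 * #(link E R i a)) / (m + 1)
      + 64 * l ^ 2 / ((m : ℝ) + 1) ^ 2) ≤
      Real.exp (-(l * (#(link E R i a) / ((m : ℝ) + 1) ^ 2))) *
        Real.exp (68 * l ^ 2 / ((m : ℝ) + 1) ^ 2) := by
    intro i a
    set d : ℝ := (#(link E R i a) : ℝ) with hd
    have hdm : d ≤ ((m : ℝ) + 1) ^ 2 := by
      have := card_link_le (E := E) (fun i => (hR i).le) i a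
      rw [hd]; exact_mod_cast this
    calc _ ≤ W i a * Real.exp (l / (m : ℝ) ^ 2 * (2 * d) / (m + 1)
          + 64 * l ^ 2 / ((m : ℝ) + 1) ^ 2) := by
          refine mul_le_mul_of_nonneg_left ?_ (Real.exp_pos _).le
          have := Real.add_one_le_exp (l / (m : ℝ) ^ 2 * (2 * d) / (m + 1)
            + 64 * l ^ 2 / ((m : ℝ) + 1) ^ 2)
          linarith
      _ ≤ _ := by
        rw [hW, ← Real.exp_add, ← Real.exp_add, Real.exp_le_exp]
        -- The relative degree after an average loss, d/m² · (1 - 2/(m+1)), falls short of the old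
        -- d/(m+1)² by exactly d/(m²(m+1)²). This supplies the 4 in 68 = 64 + 4; the 64 is the
        -- square of 8l/(m+1).
        have h1 : -(l * (d / (m : ℝ) ^ 2)) + l / (m : ℝ) ^ 2 * (2 * d) / (m + 1)
            = -(l * (d / ((m : ℝ) + 1) ^ 2)) + l * d / ((m : ℝ) ^ 2 * ((m : ℝ) + 1) ^ 2) := by
          field_simp; ring
        have h2 : l * d / ((m : ℝ) ^ 2 * ((m : ℝ) + 1) ^ 2) ≤ 4 * l ^ 2 / ((m : ℝ) + 1) ^ 2 := by
          calc l * d / ((m : ℝ) ^ 2 * ((m : ℝ) + 1) ^ 2)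
              ≤ l * ((m : ℝ) + 1) ^ 2 / ((m : ℝ) ^ 2 * ((m : ℝ) + 1) ^ 2) := by gcongr
            _ = l / (m : ℝ) ^ 2 := by field_simp
            _ ≤ 4 * l ^ 2 / ((m : ℝ) + 1) ^ 2 := by
              rw [div_le_div_iff₀ (by positivity) (by positivity)]
              have h3 : ((m : ℝ) + 1) ^ 2 ≤ 4 * (m : ℝ) ^ 2 := by nlinarith
              have h4 : l ≤ l ^ 2 := by nlinarith
              calc l * ((m : ℝ) + 1) ^ 2 ≤ l ^ 2 * (4 * (m : ℝ) ^ 2) := by gcongr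
                _ = _ := by ring
        have h3 : 68 * l ^ 2 / ((m : ℝ) + 1) ^ 2
          = 64 * l ^ 2 / ((m : ℝ) + 1) ^ 2 + 4 * l ^ 2 / ((m : ℝ) + 1) ^ 2 := by ring
        linarith
  have havg : ∑ i, ∑ a, W i a * u i a ≤
      ∑ i, ∑ a, W i a * (l / (m : ℝ) ^ 2 * (2 * #(link E R i a)) / ((m : ℝ) + 1)) := by
    have : ∑ i, ∑ a, W i a * (l / (m : ℝ) ^ 2 * (2 * (#(link E R i a) : ℝ)) / ((m : ℝ) + 1))
        = (∑ i, ∑ a, W i a * (l / (m : ℝ) ^ 2 * (2 * (#(link E R i a) : ℝ)))) / ((m : ℝ) + 1) := by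
      simp only [sum_div, mul_div_assoc']
    rw [this, le_div_iff₀ hM]
    push_cast at hcost
    linarith
  calc potential E l m (fun j => (R j).erase (f j))
      ≤ ∑ i, ∑ a, W i a * (1 + u i a + 64 * l ^ 2 / ((m : ℝ) + 1) ^ 2) :=
        sum_le_sum fun i _ => sum_le_sum fun a _ => hterm i a
    _ ≤ ∑ i, ∑ a, W i a * (1 + l / (m : ℝ) ^ 2 * (2 * #(link E R i a)) / (m + 1)
          + 64 * l ^ 2 / ((m : ℝ) + 1) ^ 2) := by
        simp only [mul_add, sum_add_distrib]
        gcongr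
    _ ≤ ∑ i, ∑ a, Real.exp (-(l * (#(link E R i a) / ((m : ℝ) + 1) ^ 2))) *
        Real.exp (68 * l ^ 2 / ((m : ℝ) + 1) ^ 2) :=
        sum_le_sum fun i _ => sum_le_sum fun a _ => hterm2 i a
    _ = _ := by
        simp only [potential, sum_mul]
        push_cast; rfl

end

/-- Some pairwise disjoint edges of `E` cover exactly the vertices in `R`. -/
def Tiled (E : Finset (Fin 3 → V)) (R : Fin 3 → Finset V) : Prop :=
  ∃ M ⊆ E, (∀ f ∈ M, ∀ g ∈ M, f ≠ g → ∀ i, f i ≠ g i) ∧ ∀ i, M.image (fun f => f i) = R i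

theorem tiled_empty (E : Finset (Fin 3 → V)) : Tiled E fun _ => ∅ :=
  ⟨∅, by simp, by simp, by simp⟩

theorem tiled_singleton {E : Finset (Fin 3 → V)} {f : Fin 3 → V} (hf : f ∈ E) :
    Tiled E fun i => {f i} :=
  ⟨{f}, by simpa using hf, by simp, by simp⟩

theorem Tiled.union {E : Finset (Fin 3 → V)} {R S : Fin 3 → Finset V} (hR : Tiled E R)
    (hS : Tiled E S) (h : ∀ i, Disjoint (R i) (S i)) : Tiled E fun i => R i ∪ S i := by
  obtain ⟨M, hME, hM, hMR⟩ := hR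
  obtain ⟨N, hNE, hN, hNS⟩ := hS
  have hMN : ∀ f ∈ M, ∀ g ∈ N, ∀ i, f i ≠ g i := by
    intro f hf g hg i
    refine (disjoint_iff_ne.1 (h i)) _ ?_ _ ?_
    · rw [← hMR]; exact mem_image_of_mem _ hf
    · rw [← hNS]; exact mem_image_of_mem _ hg
  refine ⟨M ∪ N, union_subset hME hNE, ?_, fun i => by rw [image_union, hMR, hNS]⟩
  intro f hf g hg hfg i
  rcases mem_union.1 hf with hf | hf <;> rcases mem_union.1 hg with hg | hg
  · exact hM f hf g hg hfg i
  · exact hMN f hf g hg i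
  · exact (hMN g hg f hf i).symm
  · exact hN f hf g hg hfg i

theorem Tiled.insert {E : Finset (Fin 3 → V)} {R : Fin 3 → Finset V} {f : Fin 3 → V}
    (hR : Tiled E R) (hf : f ∈ E) (h : ∀ i, f i ∉ R i) :
    Tiled E fun i => insert (f i) (R i) := by
  simpa only [insert_eq] using (tiled_singleton hf).union hR fun i => by simpa using h i

section

variable [Fintype V]

theorem exp_le_potential (E : Finset (Fin 3 → V)) (l : ℝ) (m : ℕ) (R : Fin 3 → Finset V)
    (i : Fin 3) (a : V) :
    Real.exp (-(l * (#(link E R i a) / (m : ℝ) ^ 2))) ≤ potential E l m R := by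
  have h1 : ∑ a : V, Real.exp (-(l * (#(link E R i a) / (m : ℝ) ^ 2))) ≤ potential E l m R :=
    single_le_sum (f := fun i => ∑ a : V, Real.exp (-(l * (#(link E R i a) / (m : ℝ) ^ 2))))
      (fun _ _ => sum_nonneg fun _ _ => (Real.exp_pos _).le) (mem_univ i)
  exact le_trans (single_le_sum (f := fun a => Real.exp (-(l * (#(link E R i a) / (m : ℝ) ^ 2))))
    (fun _ _ => (Real.exp_pos _).le) (mem_univ a)) h1

/-- Removing edges greedily, one can tile all but `m₀` vertices of each class. -/
theorem exists_tiled_of_potential (E : Finset (Fin 3 → V)) {l : ℝ} (hl : 1 ≤ l) {m₀ : ℕ}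
    (hm₀ : 1 ≤ m₀) (hlm : 8 * l ≤ m₀) {N : ℕ} (hN : m₀ ≤ N) : ∀ R : Fin 3 → Finset V,
    (∀ i, #(R i) = N) → potential E l N R * Real.exp (68 * l ^ 2 / m₀ - 68 * l ^ 2 / N) <
      Real.exp (-(l * (5 / 9))) →
    ∃ R' : Fin 3 → Finset V, (∀ i, R' i ⊆ R i) ∧ (∀ i, #(R' i) = m₀) ∧
      Tiled E fun i => R i \ R' i := by
  induction N, hN using Nat.le_induction with
  | base =>
    intro R hR _
    exact ⟨R, fun _ => Subset.rfl, hR, by simpa using tiled_empty E⟩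
  | succ m hm ih =>
    intro R hR hpot
    have hm1 : 1 ≤ m := hm₀.trans hm
    have hm0 : (0 : ℝ) < m := by exact_mod_cast hm1
    have hm₀' : (0 : ℝ) < m₀ := by exact_mod_cast hm₀
    have hmm : (m₀ : ℝ) ≤ m := by exact_mod_cast hm
    have hpot0 : 0 ≤ potential E l (m + 1) R :=
      sum_nonneg fun _ _ => sum_nonneg fun _ _ => (Real.exp_pos _).le
    -- A single vertex of relative degree at most 5/9 would contribute at least exp(-5l/9), more
    -- than the whole potential.
    obtain ⟨f, hfE, hfR, hf⟩ := exists_edge_potential_le E R hm1 hR (fun i a _ => by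
      have h1 := exp_le_potential E l (m + 1) R i a
      have h2 : potential E l (m + 1) R ≤ potential E l (m + 1) R *
          Real.exp (68 * l ^ 2 / m₀ - 68 * l ^ 2 / (m + 1 : ℕ)) := by
        refine le_mul_of_one_le_right hpot0 (Real.one_le_exp ?_)
        rw [sub_nonneg]
        gcongr
        linarith
      have h3 := Real.exp_lt_exp.1 ((h1.trans h2).trans_lt hpot)
      have h4 := lt_of_mul_lt_mul_left (neg_lt_neg_iff.1 h3) (by linarith)
      rwa [lt_div_iff₀ (by positivity)] at h4) hl (by linarith)
    -- The errors telescope: 1/(m+1)² ≤ 1/m - 1/(m+1).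
    have hstep : 68 * l ^ 2 / ((m : ℝ) + 1) ^ 2 - 68 * l ^ 2 / m ≤ - (68 * l ^ 2 / ((m : ℝ) + 1)) := by
      have h1 : 1 / ((m : ℝ) + 1) ^ 2 + 1 / ((m : ℝ) + 1) ≤ 1 / m := by
        rw [div_add_div _ _ (by positivity) (by positivity),
          div_le_div_iff₀ (by positivity) (by positivity)]
        nlinarith [sq_nonneg (m : ℝ)]
      have h2 := mul_le_mul_of_nonneg_left h1 (show 0 ≤ 68 * l ^ 2 by positivity)
      have h3 : 68 * l ^ 2 * (1 / ((m : ℝ) + 1) ^ 2 + 1 / ((m : ℝ) + 1)) =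
        68 * l ^ 2 / ((m : ℝ) + 1) ^ 2 + 68 * l ^ 2 / ((m : ℝ) + 1) := by ring
      have h4 : 68 * l ^ 2 * (1 / (m : ℝ)) = 68 * l ^ 2 / m := by ring
      linarith
    obtain ⟨R', hR', hcard, ht⟩ := ih (fun j => (R j).erase (f j))
      (fun j => by rw [card_erase_of_mem (hfR j), hR, Nat.add_sub_cancel]) (by
        refine lt_of_le_of_lt ?_ hpot
        refine (mul_le_mul_of_nonneg_right hf (Real.exp_pos _).le).trans ?_
        rw [mul_assoc, ← Real.exp_add]
        refine mul_le_mul_of_nonneg_left (Real.exp_le_exp.2 ?_) hpot0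
        push_cast
        linarith)
    refine ⟨R', fun i => (hR' i).trans (erase_subset _ _), hcard, ?_⟩
    have hnot : ∀ i, f i ∉ R' i := fun i hi => notMem_erase _ _ (hR' i hi)
    convert ht.insert hfE (fun i => by simp) using 2 with i
    ext x
    simp only [mem_sdiff, mem_insert, mem_erase]
    by_cases hx : x = f i
    · subst hx; simp [hfR i, hnot i]
    · simp [hx]

theorem exists_tiled_of_degree (E : Finset (Fin 3 → V)) {l γ : ℝ} (hl : 1 ≤ l) {m₀ N : ℕ}
    (hm₀ : 1 ≤ m₀) (hlm : 8 * l ≤ m₀) (hN : m₀ ≤ N) (R : Fin 3 → Finset V)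
    (hR : ∀ i, #(R i) = N) (hdeg : ∀ i a, (5 / 9 + γ) * (N : ℝ) ^ 2 ≤ #(link E R i a))
    (hlarge : 3 * Fintype.card V * Real.exp (68 * l ^ 2 / m₀) < Real.exp (l * γ)) :
    ∃ R' : Fin 3 → Finset V, (∀ i, R' i ⊆ R i) ∧ (∀ i, #(R' i) = m₀) ∧
      Tiled E fun i => R i \ R' i := by
  refine exists_tiled_of_potential E hl hm₀ hlm hN R hR ?_
  have hN0 : (0 : ℝ) < N := by exact_mod_cast hm₀.trans hN
  have h1 : potential E l N R ≤ 3 * Fintype.card V * Real.exp (-(l * (5 / 9 + γ))) := by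
    have : potential E l N R ≤ ∑ i : Fin 3, ∑ a : V, Real.exp (-(l * (5 / 9 + γ))) := by
      refine sum_le_sum fun i _ => sum_le_sum fun a _ => Real.exp_le_exp.2 (neg_le_neg ?_)
      refine mul_le_mul_of_nonneg_left ?_ (by linarith)
      rw [le_div_iff₀ (by positivity)]
      exact hdeg i a
    refine this.trans (le_of_eq ?_)
    simp [mul_assoc]
  have h2 : Real.exp (68 * l ^ 2 / m₀ - 68 * l ^ 2 / N) ≤ Real.exp (68 * l ^ 2 / m₀) :=
    Real.exp_le_exp.2 (sub_le_self _ (by positivity))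
  calc _ ≤ 3 * Fintype.card V * Real.exp (-(l * (5 / 9 + γ))) * Real.exp (68 * l ^ 2 / m₀) := by
        gcongr
    _ = 3 * Fintype.card V * Real.exp (68 * l ^ 2 / m₀) * Real.exp (-(l * (5 / 9 + γ))) := by ring
    _ < Real.exp (l * γ) * Real.exp (-(l * (5 / 9 + γ))) :=
        mul_lt_mul_of_pos_right hlarge (Real.exp_pos _)
    _ = _ := by rw [← Real.exp_add]; ring_nf

end

/-! ### Absorbing pairs of edges. -/

/-- The vertices in class `i` of a pair of edges. -/
def verts (p : (Fin 3 → V) × (Fin 3 → V)) (i : Fin 3) : Finset V := {p.1 i, p.2 i}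

/-- The edge pair `p`, together with the transversal triple `T`, can be covered by three edges. -/
def Absorbs (E : Finset (Fin 3 → V)) (p : (Fin 3 → V) × (Fin 3 → V)) (T : Fin 3 → V) : Prop :=
  ![T 0, p.1 1, p.2 2] ∈ E ∧ Function.update p.1 1 (T 1) ∈ E ∧ Function.update p.2 2 (T 2) ∈ E

instance (E : Finset (Fin 3 → V)) (p : (Fin 3 → V) × (Fin 3 → V)) (T : Fin 3 → V) :
    Decidable (Absorbs E p T) := inferInstanceAs (Decidable (_ ∧ _ ∧ _))

/-- A pairwise disjoint family of pairs of disjoint edges. -/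
structure IsAbsorbingFamily (E : Finset (Fin 3 → V))
    (A : Finset ((Fin 3 → V) × (Fin 3 → V))) : Prop where
  fst_mem : ∀ p ∈ A, p.1 ∈ E
  snd_mem : ∀ p ∈ A, p.2 ∈ E
  ne : ∀ p ∈ A, ∀ i, p.1 i ≠ p.2 i
  disjoint : ∀ p ∈ A, ∀ q ∈ A, p ≠ q → ∀ i, Disjoint (verts p i) (verts q i)

theorem IsAbsorbingFamily.subset {E : Finset (Fin 3 → V)}
    {A B : Finset ((Fin 3 → V) × (Fin 3 → V))} (hA : IsAbsorbingFamily E A) (h : B ⊆ A) :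
    IsAbsorbingFamily E B :=
  ⟨fun p hp => hA.fst_mem p (h hp), fun p hp => hA.snd_mem p (h hp), fun p hp => hA.ne p (h hp),
    fun p hp q hq => hA.disjoint p (h hp) q (h hq)⟩

theorem IsAbsorbingFamily.card_biUnion {E : Finset (Fin 3 → V)}
    {A : Finset ((Fin 3 → V) × (Fin 3 → V))} (hA : IsAbsorbingFamily E A) (i : Fin 3) :
    #(A.biUnion fun p => verts p i) = 2 * #A := by
  have h2 : ∀ p ∈ A, #(verts p i) = 2 := fun p hp => card_pair (hA.ne p hp i)
  rw [Finset.card_biUnion fun p hp q hq hpq => hA.disjoint p hp q hq hpq i, sum_const_nat h2,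
    mul_comm]

theorem IsAbsorbingFamily.disjoint_erase {E : Finset (Fin 3 → V)}
    {A : Finset ((Fin 3 → V) × (Fin 3 → V))} (hA : IsAbsorbingFamily E A)
    {p : (Fin 3 → V) × (Fin 3 → V)} (hp : p ∈ A) (i : Fin 3) :
    Disjoint (verts p i) ((A.erase p).biUnion fun p => verts p i) :=
  (disjoint_biUnion_right _ _ _).2 fun q hq =>
    hA.disjoint p hp q (mem_of_mem_erase hq) (ne_of_mem_erase hq).symm i

theorem biUnion_verts_erase {A : Finset ((Fin 3 → V) × (Fin 3 → V))}
    {p : (Fin 3 → V) × (Fin 3 → V)} (hp : p ∈ A) (i : Fin 3) :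
    (A.biUnion fun p => verts p i) = verts p i ∪ (A.erase p).biUnion fun p => verts p i := by
  conv_lhs => rw [← insert_erase hp]
  rw [biUnion_insert]

theorem tiled_verts {E : Finset (Fin 3 → V)} {p : (Fin 3 → V) × (Fin 3 → V)} (h1 : p.1 ∈ E)
    (h2 : p.2 ∈ E) (h : ∀ i, p.1 i ≠ p.2 i) : Tiled E (verts p) :=
  (tiled_singleton h2).insert h1 fun i => by simpa using h i

theorem IsAbsorbingFamily.tiled {E : Finset (Fin 3 → V)}
    {A : Finset ((Fin 3 → V) × (Fin 3 → V))} (hA : IsAbsorbingFamily E A) :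
    Tiled E fun i => A.biUnion fun p => verts p i := by
  induction A using Finset.strongInduction with
  | H A ih =>
    rcases A.eq_empty_or_nonempty with rfl | ⟨p, hp⟩
    · simpa using tiled_empty E
    · have := (tiled_verts (hA.fst_mem p hp) (hA.snd_mem p hp) (hA.ne p hp)).union
        (ih _ (erase_ssubset hp) (hA.subset (erase_subset _ _))) (hA.disjoint_erase hp)
      simpa only [biUnion_verts_erase hp] using this

theorem tiled_of_absorbs {E : Finset (Fin 3 → V)} {p : (Fin 3 → V) × (Fin 3 → V)}
    {T : Fin 3 → V} (h : Absorbs E p T) (hne : ∀ i, p.1 i ≠ p.2 i) (hT : ∀ i, T i ∉ verts p i) :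
    Tiled E fun i => insert (T i) (verts p i) := by
  obtain ⟨h0, h1, h2⟩ := h
  have ht : ∀ i, T i ≠ p.1 i ∧ T i ≠ p.2 i := fun i => by simpa [verts] using hT i
  have := ((tiled_singleton h2).insert h1 fun i => ?_).insert h0 fun i => ?_
  · convert this using 2 with i
    fin_cases i <;> ext x <;> simp [verts] <;> tauto
  · fin_cases i
    · simpa using hne 0
    · simpa using (ht 1).2
    · simpa using (ht 2).1.symm
  · fin_cases i
    · simpa using ht 0
    · simpa using ⟨(ht 1).1.symm, hne 1⟩
    · simpa using ⟨(hne 2).symm, (ht 2).2.symm⟩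

/-- A family with many absorbers for every triple absorbs any small balanced set. -/
theorem IsAbsorbingFamily.tiled_union {E : Finset (Fin 3 → V)} (k : ℕ) :
    ∀ {A : Finset ((Fin 3 → V) × (Fin 3 → V))} (_ : IsAbsorbingFamily E A)
      (_ : ∀ T, k ≤ #(A.filter fun p => Absorbs E p T)) (R : Fin 3 → Finset V)
      (_ : ∀ i, #(R i) = k) (_ : ∀ i, Disjoint (R i) (A.biUnion fun p => verts p i)),
      Tiled E fun i => R i ∪ A.biUnion fun p => verts p i := by
  induction k with
  | zero =>
    intro A hA _ R hR _
    simpa only [card_eq_zero.1 (hR _), empty_union] using hA.tiled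
  | succ k ih =>
    intro A hA hcount R hR hdisj
    have hT : ∀ i, ∃ x, x ∈ R i := fun i => card_pos.1 (by rw [hR i]; exact Nat.succ_pos k)
    choose T hT using hT
    obtain ⟨p, hp⟩ := card_pos.1 ((Nat.succ_pos k).trans_le (hcount T))
    obtain ⟨hpA, hpT⟩ := mem_filter.1 hp
    have hsub : ∀ i, verts p i ⊆ A.biUnion fun p => verts p i := fun i =>
      subset_biUnion_of_mem (fun p => verts p i) hpA
    have hsub' : ∀ i, ((A.erase p).biUnion fun p => verts p i) ⊆ A.biUnion fun p => verts p i :=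
      fun i => biUnion_subset_biUnion_of_subset_left _ (erase_subset _ _)
    -- Spending p costs every triple at most one absorber, while the remainder shrinks by one vertex
    -- per class.
    have h1 := ih (hA.subset (erase_subset p A)) (fun S => by
        rw [filter_erase]
        exact (Nat.le_sub_one_of_lt (hcount S)).trans pred_card_le_card_erase)
      (fun i => (R i).erase (T i)) (fun i => by rw [card_erase_of_mem (hT i), hR]; rfl)
      (fun i => (hdisj i).mono (erase_subset _ _) (hsub' i))
    have h2 := tiled_of_absorbs hpT (hA.ne p hpA)
      (fun i h => disjoint_left.1 (hdisj i) (hT i) (hsub i h))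
    have := h2.union h1 fun i => by
      rw [disjoint_insert_left, disjoint_union_right]
      refine ⟨?_, (hdisj i).symm.mono (hsub i) (erase_subset _ _), hA.disjoint_erase hpA i⟩
      rw [mem_union, not_or]
      exact ⟨notMem_erase _ _, fun h => disjoint_left.1 (hdisj i) (hT i) (hsub' i h)⟩
    convert this using 2 with i
    rw [biUnion_verts_erase hpA]
    conv_lhs => rw [← insert_erase (hT i)]
    ext x
    simp only [mem_union, mem_insert]
    tauto

/-! ### Counting absorbers and selecting the absorbing family. -/

section

variable [Fintype V]

theorem card_filter_apply_eq_le (i : Fin 3) (a : V) :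
    #((univ : Finset (Fin 3 → V)).filter fun f => f i = a) ≤ Fintype.card V ^ 2 := by
  have := card_link_le (E := (univ : Finset (Fin 3 → V))) (R := fun _ => univ)
    (m := Fintype.card V) (fun _ => le_rfl) i a
  simpa [link] using this

/-- Two vertices of large degree have many common neighbouring pairs. -/
theorem card_common_link_ge (E : Finset (Fin 3 → V)) (i : Fin 3) (a b : V) :
    #(link E (fun _ => univ) i a) + #(link E (fun _ => univ) i b) ≤
      #(E.filter fun f => f i = a ∧ Function.update f i b ∈ E) + Fintype.card V ^ 2 := by
  -- Links are compared by moving b to a; both then lie among the at most n² tuples through a, and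
  -- inclusion–exclusion applies.
  set B := (link E (fun _ => univ) i b).image fun f => Function.update f i a with hB
  have hBcard : #B = #(link E (fun _ => univ) i b) := by
    refine card_image_of_injOn fun f hf g hg hfg => ?_
    have hf : f ∈ link E (fun _ => univ) i b := hf
    have hg : g ∈ link E (fun _ => univ) i b := hg
    have h := congrArg (fun h => Function.update h i b) hfg
    simp only [Function.update_idem] at h
    rwa [← (mem_link.1 hf).2.1, Function.update_eq_self, (mem_link.1 hf).2.1,
      ← (mem_link.1 hg).2.1, Function.update_eq_self] at h
  have hinter : link E (fun _ => univ) i a ∩ B ⊆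
      E.filter fun f => f i = a ∧ Function.update f i b ∈ E := by
    intro f hf
    obtain ⟨h1, h2⟩ := mem_inter.1 hf
    obtain ⟨g, hg, rfl⟩ := mem_image.1 h2
    obtain ⟨hgE, hgb, -⟩ := mem_link.1 hg
    refine mem_filter.2 ⟨(mem_link.1 h1).1, by simp, ?_⟩
    rw [Function.update_idem, ← hgb, Function.update_eq_self]
    exact hgE
  have hunion : link E (fun _ => univ) i a ∪ B ⊆ univ.filter fun f => f i = a := by
    refine union_subset (fun f hf => by simpa using (mem_link.1 hf).2.1) fun f hf => ?_
    obtain ⟨g, -, rfl⟩ := mem_image.1 hf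
    simp
  have h1 := card_union_add_card_inter (link E (fun _ => univ) i a) B
  have h2 := card_le_card hinter
  have h3 := (card_le_card hunion).trans (card_filter_apply_eq_le i a)
  omega

/-- Choose the edge e through T 0 in at least 5n²/9 ways. It fixes `p.1 1` and `p.2 2`, after which
each of `p.1`, `p.2` ranges over a common link of size at least n²/9. -/
theorem card_absorbs_ge (E : Finset (Fin 3 → V))
    (hdeg : ∀ i a, 5 / 9 * (Fintype.card V : ℝ) ^ 2 ≤ #(link E (fun _ => univ) i a))
    (T : Fin 3 → V) : 5 / 729 * (Fintype.card V : ℝ) ^ 6 ≤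
      #((E ×ˢ E).filter fun p => Absorbs E p T) := by
  set n : ℝ := (Fintype.card V : ℝ) with hn
  have hcommon : ∀ i a b, 1 / 9 * n ^ 2 ≤
      #(E.filter fun f => f i = a ∧ Function.update f i b ∈ E) := by
    intro i a b
    have h1 : ((_ : ℕ) : ℝ) ≤ _ := Nat.cast_le.2 (card_common_link_ge E i a b)
    push_cast at h1
    linarith [hdeg i a, hdeg i b]
  have hmaps : ∀ p ∈ (E ×ˢ E).filter (fun p => Absorbs E p T),
      ![T 0, p.1 1, p.2 2] ∈ link E (fun _ => univ) 0 (T 0) := by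
    intro p hp
    exact mem_link.2 ⟨(mem_filter.1 hp).2.1, rfl, fun _ _ => mem_univ _⟩
  rw [card_eq_sum_card_fiberwise hmaps]
  push_cast
  have hfib : ∀ e ∈ link E (fun _ => univ) 0 (T 0), 1 / 81 * n ^ 4 ≤
      (#(((E ×ˢ E).filter fun p => Absorbs E p T).filter
        fun p => ![T 0, p.1 1, p.2 2] = e) : ℝ) := by
    intro e he
    obtain ⟨heE, he0, -⟩ := mem_link.1 he
    have hsub : (E.filter fun f => f 1 = e 1 ∧ Function.update f 1 (T 1) ∈ E) ×ˢ
        (E.filter fun f => f 2 = e 2 ∧ Function.update f 2 (T 2) ∈ E) ⊆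
        ((E ×ˢ E).filter fun p => Absorbs E p T).filter fun p => ![T 0, p.1 1, p.2 2] = e := by
      rintro ⟨f, g⟩ hfg
      simp only [mem_product, mem_filter] at hfg
      obtain ⟨⟨hf, hf1, hf2⟩, hg, hg1, hg2⟩ := hfg
      have hee : ![T 0, f 1, g 2] = e := by
        funext i
        fin_cases i
        · exact he0.symm
        · exact hf1
        · exact hg1
      simp only [mem_filter, mem_product]
      exact ⟨⟨⟨hf, hg⟩, hee ▸ heE, hf2, hg2⟩, hee⟩
    have h1 : ((_ : ℕ) : ℝ) ≤ _ := Nat.cast_le.2 (card_le_card hsub)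
    rw [card_product] at h1
    push_cast at h1
    calc 1 / 81 * n ^ 4 = (1 / 9 * n ^ 2) * (1 / 9 * n ^ 2) := by ring
      _ ≤ _ := mul_le_mul (hcommon _ _ _) (hcommon _ _ _) (by positivity) (Nat.cast_nonneg _)
      _ ≤ _ := h1
  calc 5 / 729 * n ^ 6 = (5 / 9 * n ^ 2) * (1 / 81 * n ^ 4) := by ring
    _ ≤ #(link E (fun _ => univ) 0 (T 0)) * (1 / 81 * n ^ 4) :=
      mul_le_mul_of_nonneg_right (hdeg _ _) (by positivity)
    _ = ∑ _e ∈ link E (fun _ => univ) 0 (T 0), (1 / 81 * n ^ 4) := by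
      rw [sum_const, nsmul_eq_mul]
    _ ≤ _ := sum_le_sum hfib

theorem card_filter_apply_mem_le (i : Fin 3) (U : Finset V) :
    #((univ : Finset (Fin 3 → V)).filter fun f => f i ∈ U) ≤ #U * Fintype.card V ^ 2 := by
  rw [card_eq_sum_card_fiberwise (f := fun f => f i) (t := U)
    (fun f hf => by simpa using hf)]
  refine (sum_le_sum fun a _ => (card_le_card ?_).trans (card_filter_apply_eq_le i a)).trans
    (by rw [sum_const, smul_eq_mul])
  exact filter_subset_filter _ (filter_subset _ _)

/-- Few pairs of edges intersect each other or a given small set. -/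
theorem card_bad_pairs_le (U : Fin 3 → Finset V) {s : ℕ} (hU : ∀ i, #(U i) ≤ s) :
    #((univ : Finset ((Fin 3 → V) × (Fin 3 → V))).filter fun p =>
      ∃ i, p.1 i = p.2 i ∨ p.1 i ∈ U i ∨ p.2 i ∈ U i) ≤ (3 + 6 * s) * Fintype.card V ^ 5 := by
  set n := Fintype.card V with hn
  have hcard3 : Fintype.card (Fin 3 → V) = n ^ 3 := by simp [hn]
  have hsub : (univ : Finset ((Fin 3 → V) × (Fin 3 → V))).filter (fun p =>
      ∃ i, p.1 i = p.2 i ∨ p.1 i ∈ U i ∨ p.2 i ∈ U i) ⊆ univ.biUnion fun i : Fin 3 =>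
      (univ.filter fun p : (Fin 3 → V) × (Fin 3 → V) => p.1 i = p.2 i) ∪
        ((univ.filter fun f : Fin 3 → V => f i ∈ U i) ×ˢ univ ∪
          univ ×ˢ (univ.filter fun f : Fin 3 → V => f i ∈ U i)) := by
    intro p hp
    simpa using hp
  have h1 : ∀ i : Fin 3, #(univ.filter fun p : (Fin 3 → V) × (Fin 3 → V) => p.1 i = p.2 i)
      ≤ n ^ 5 := by
    intro i
    rw [card_eq_sum_card_fiberwise (f := Prod.fst) (t := univ) (fun _ _ => mem_univ _)]
    calc _ ≤ ∑ f : Fin 3 → V, n ^ 2 := by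
          refine sum_le_sum fun f _ => ?_
          refine (card_le_card_of_injOn Prod.snd (t := univ.filter fun g : Fin 3 → V => g i = f i)
            ?_ ?_).trans (card_filter_apply_eq_le i (f i))
          · rintro ⟨f', g⟩ hp
            obtain ⟨h1, h2⟩ : f' i = g i ∧ f' = f := by simpa using hp
            subst h2
            simpa using h1.symm
          · rintro ⟨f₁, g₁⟩ hp ⟨f₂, g₂⟩ hq h
            have h1 : f₁ i = g₁ i ∧ f₁ = f := by simpa using hp
            have h2 : f₂ i = g₂ i ∧ f₂ = f := by simpa using hq
            rw [h1.2, h2.2]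
            exact Prod.ext rfl h
      _ = n ^ 5 := by rw [sum_const, card_univ, hcard3, smul_eq_mul]; ring
  have h2 : ∀ i : Fin 3, #(univ.filter fun f : Fin 3 → V => f i ∈ U i) ≤ s * n ^ 2 := fun i =>
    (card_filter_apply_mem_le i (U i)).trans (Nat.mul_le_mul_right _ (hU i))
  refine (card_le_card hsub).trans (card_biUnion_le.trans ?_)
  calc _ ≤ ∑ i : Fin 3, (n ^ 5 + (s * n ^ 2 * n ^ 3 + n ^ 3 * (s * n ^ 2))) := by
        refine sum_le_sum fun i _ => (card_union_le _ _).trans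
          (Nat.add_le_add (h1 i) ((card_union_le _ _).trans ?_))
        rw [card_product, card_product, card_univ, hcard3]
        exact Nat.add_le_add (Nat.mul_le_mul_right _ (h2 i)) (Nat.mul_le_mul_left _ (h2 i))
    _ = _ := by rw [sum_const, card_univ, Fintype.card_fin, smul_eq_mul]; ring

/-- The weight that decreases when triples acquire absorbers. -/
noncomputable def deficiency (E : Finset (Fin 3 → V))
    (A : Finset ((Fin 3 → V) × (Fin 3 → V))) : ℝ :=
  ∑ T : Fin 3 → V, (1 / 2 : ℝ) ^ #(A.filter fun p => Absorbs E p T)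

/-- Pairs that meet themselves or A number at most n⁶/729, so each triple keeps at least 4n⁶/729 ≥
n⁶/200 usable absorbers. By averaging, some pair absorbs triples carrying 1/200 of the weight, and
these weights are halved. -/
theorem exists_insert_absorbing (E : Finset (Fin 3 → V)) [Nonempty V]
    (hdeg : ∀ i a, 5 / 9 * (Fintype.card V : ℝ) ^ 2 ≤ #(link E (fun _ => univ) i a))
    {A : Finset ((Fin 3 → V) × (Fin 3 → V))} (hA : IsAbsorbingFamily E A)
    (hcard : 729 * (3 + 12 * #A) ≤ Fintype.card V) :
    ∃ p ∉ A, IsAbsorbingFamily E (insert p A) ∧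
      deficiency E (insert p A) ≤ 399 / 400 * deficiency E A := by
  set n : ℝ := (Fintype.card V : ℝ) with hn
  have hn0 : 0 < n := by rw [hn]; exact_mod_cast Fintype.card_pos
  set U : Fin 3 → Finset V := fun i => A.biUnion fun p => verts p i with hU
  set bad := (univ : Finset ((Fin 3 → V) × (Fin 3 → V))).filter fun p =>
    ∃ i, p.1 i = p.2 i ∨ p.1 i ∈ U i ∨ p.2 i ∈ U i with hbad
  set good := (E ×ˢ E) \ bad with hgood
  have hbadcard : (#bad : ℝ) ≤ 1 / 729 * n ^ 6 := by
    have h1 := card_bad_pairs_le U (s := 2 * #A) fun i => (hA.card_biUnion i).le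
    have h2 : (#bad : ℝ) ≤ _ := Nat.cast_le.2 h1
    have h3 : (729 : ℝ) * (3 + 12 * #A) ≤ n := by rw [hn]; exact_mod_cast hcard
    push_cast at h2
    refine h2.trans ?_
    have : (3 + 6 * (2 * (#A : ℝ))) ≤ 1 / 729 * n := by linarith
    calc _ ≤ (1 / 729 * n) * n ^ 5 := mul_le_mul_of_nonneg_right this (by positivity)
      _ = _ := by ring
  have hgoodT : ∀ T, 1 / 200 * n ^ 6 ≤ #(good.filter fun p => Absorbs E p T) := by
    intro T
    have h1 := card_absorbs_ge E hdeg T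
    have h2 : #((E ×ˢ E).filter fun p => Absorbs E p T) ≤
        #(good.filter fun p => Absorbs E p T) + #bad := by
      refine (card_le_card fun p hp => ?_).trans (card_union_le _ _)
      obtain ⟨h1, h2⟩ := mem_filter.1 hp
      by_cases hb : p ∈ bad
      · exact mem_union_right _ hb
      · exact mem_union_left _ (mem_filter.2 ⟨mem_sdiff.2 ⟨h1, hb⟩, h2⟩)
    have h3 : ((_ : ℕ) : ℝ) ≤ _ := Nat.cast_le.2 h2
    push_cast at h3
    have h4 : 0 < n ^ 6 := by positivity
    linarith
  set w : (Fin 3 → V) → ℝ := fun T => (1 / 2 : ℝ) ^ #(A.filter fun p => Absorbs E p T) with hw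
  have hw0 : ∀ T, 0 < w T := fun T => by simp only [hw]; positivity
  have hdef0 : 0 < deficiency E A := sum_pos (fun T _ => hw0 T) univ_nonempty
  have havg : ∃ p ∈ good, 1 / 200 * deficiency E A ≤ ∑ T with Absorbs E p T, w T := by
    by_contra! hcon
    have h1 : ∑ p ∈ good, ∑ T with Absorbs E p T, w T =
        ∑ T, #(good.filter fun p => Absorbs E p T) * w T := by
      simp only [sum_filter]
      rw [sum_comm]
      refine sum_congr rfl fun T _ => ?_
      rw [← sum_filter, sum_const, nsmul_eq_mul]
    have h2 : 1 / 200 * n ^ 6 * deficiency E A ≤ ∑ p ∈ good, ∑ T with Absorbs E p T, w T := by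
      rw [h1, deficiency, mul_sum]
      exact sum_le_sum fun T _ => mul_le_mul_of_nonneg_right (hgoodT T) (hw0 T).le
    have hne : good.Nonempty := by
      rw [nonempty_iff_ne_empty]
      intro h
      rw [h, sum_empty] at h2
      have : 0 < 1 / 200 * n ^ 6 * deficiency E A := by positivity
      linarith
    have h3 := sum_lt_sum_of_nonempty hne hcon
    rw [sum_const, nsmul_eq_mul] at h3
    have h4 : (#good : ℝ) ≤ n ^ 6 := by
      have : #good ≤ Fintype.card V ^ 6 := by
        refine (card_le_univ _).trans (le_of_eq ?_)
        simp only [Fintype.card_prod, Fintype.card_pi, prod_const, card_univ, Fintype.card_fin]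
        ring
      rw [hn]; exact_mod_cast this
    have h5 : #good * (1 / 200 * deficiency E A) ≤ n ^ 6 * (1 / 200 * deficiency E A) :=
      mul_le_mul_of_nonneg_right h4 (by positivity)
    linarith
  obtain ⟨p, hp, hpsum⟩ := havg
  obtain ⟨hpE, hpb⟩ := mem_sdiff.1 hp
  obtain ⟨hp1, hp2⟩ := mem_product.1 hpE
  have hpb : ∀ i, p.1 i ≠ p.2 i ∧ p.1 i ∉ U i ∧ p.2 i ∉ U i := by
    simpa [hbad] using hpb
  have hdisj : ∀ q ∈ A, ∀ i, Disjoint (verts p i) (verts q i) := by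
    intro q hq i
    have hsub : verts q i ⊆ U i := subset_biUnion_of_mem (fun p => verts p i) hq
    rw [verts, disjoint_insert_left, disjoint_singleton_left]
    exact ⟨fun h => (hpb i).2.1 (hsub h), fun h => (hpb i).2.2 (hsub h)⟩
  have hpA : p ∉ A := fun h => (hpb 0).2.1 (mem_biUnion.2 ⟨p, h, by simp [verts]⟩)
  refine ⟨p, hpA, ⟨?_, ?_, ?_, ?_⟩, ?_⟩
  · intro q hq
    rcases mem_insert.1 hq with rfl | hq
    exacts [hp1, hA.fst_mem q hq]
  · intro q hq
    rcases mem_insert.1 hq with rfl | hq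
    exacts [hp2, hA.snd_mem q hq]
  · intro q hq
    rcases mem_insert.1 hq with rfl | hq
    exacts [fun i => (hpb i).1, hA.ne q hq]
  · intro q hq r hr hqr i
    rcases mem_insert.1 hq with rfl | hqA <;> rcases mem_insert.1 hr with rfl | hrA
    · exact absurd rfl hqr
    · exact hdisj r hrA i
    · exact (hdisj q hqA i).symm
    · exact hA.disjoint q hqA r hrA hqr i
  · have h1 : deficiency E (insert p A) =
        deficiency E A - 1 / 2 * ∑ T with Absorbs E p T, w T := by
      rw [deficiency, deficiency, mul_sum, sum_filter, ← sum_sub_distrib]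
      refine sum_congr rfl fun T _ => ?_
      rw [filter_insert]
      split_ifs with h
      · rw [card_insert_of_notMem (by simp [hpA]), pow_succ]
        simp only [hw]; ring
      · rw [sub_zero]
    rw [h1]; linarith

theorem exists_absorbing (E : Finset (Fin 3 → V)) [Nonempty V]
    (hdeg : ∀ i a, 5 / 9 * (Fintype.card V : ℝ) ^ 2 ≤ #(link E (fun _ => univ) i a)) (t : ℕ)
    (ht : 729 * (3 + 12 * t) ≤ Fintype.card V) :
    ∃ A, IsAbsorbingFamily E A ∧ #A = t ∧
      deficiency E A ≤ (399 / 400) ^ t * (Fintype.card V : ℝ) ^ 3 := by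
  induction t with
  | zero =>
    refine ⟨∅, ⟨by simp, by simp, by simp, by simp⟩, rfl, ?_⟩
    simp [deficiency]
  | succ t ih =>
    obtain ⟨A, hA, hcard, hle⟩ := ih (by omega)
    obtain ⟨p, hp, hpA, hple⟩ := exists_insert_absorbing E hdeg hA (by omega)
    refine ⟨insert p A, hpA, by rw [card_insert_of_notMem hp, hcard], hple.trans ?_⟩
    rw [pow_succ]
    linarith

theorem le_card_absorbers {E : Finset (Fin 3 → V)} {A : Finset ((Fin 3 → V) × (Fin 3 → V))}
    {k : ℕ} (h : deficiency E A < (1 / 2) ^ k) (T : Fin 3 → V) :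
    k ≤ #(A.filter fun p => Absorbs E p T) := by
  have h1 : (1 / 2 : ℝ) ^ #(A.filter fun p => Absorbs E p T) ≤ deficiency E A :=
    single_le_sum (f := fun T => (1 / 2 : ℝ) ^ #(A.filter fun p => Absorbs E p T))
      (fun _ _ => by positivity) (mem_univ T)
  have h2 := (pow_lt_pow_iff_right_of_lt_one₀ (by norm_num) (by norm_num)).1 (h1.trans_lt h)
  exact h2.le

theorem card_link_univ_le (E : Finset (Fin 3 → V)) (U : Fin 3 → Finset V) {s : ℕ}
    (hU : ∀ i, #(U i) ≤ s) (i : Fin 3) (a : V) :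
    #(link E (fun _ => univ) i a) ≤
      #(link E (fun j => univ \ U j) i a) + 2 * (s * Fintype.card V) := by
  have hsub : link E (fun _ => univ) i a ⊆ link E (fun j => univ \ U j) i a ∪
      (univ.erase i).biUnion fun j => (U j).biUnion fun x =>
        (link E (fun _ => univ) i a).filter fun f => f j = x := by
    intro f hf
    by_cases h : ∃ j, j ≠ i ∧ f j ∈ U j
    · obtain ⟨j, hj, hfj⟩ := h
      exact mem_union_right _ (mem_biUnion.2 ⟨j, by simpa using hj,
        mem_biUnion.2 ⟨_, hfj, mem_filter.2 ⟨hf, rfl⟩⟩⟩)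
    · push Not at h
      obtain ⟨h1, h2, -⟩ := mem_link.1 hf
      exact mem_union_left _ (mem_link.2 ⟨h1, h2, fun j hj => by simpa using h j hj⟩)
  refine (card_le_card hsub).trans ((card_union_le _ _).trans (Nat.add_le_add_left ?_ _))
  refine card_biUnion_le.trans ?_
  calc _ ≤ ∑ j ∈ univ.erase i, s * Fintype.card V := by
        refine sum_le_sum fun j hj => card_biUnion_le.trans ?_
        refine (sum_le_sum fun x _ => card_filter_link_le (m := Fintype.card V)
          (fun _ => card_le_univ _) a x (ne_of_mem_erase hj)).trans ?_
        rw [sum_const, smul_eq_mul]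
        exact Nat.mul_le_mul_right _ (hU j)
    _ = _ := by
      rw [sum_const, card_erase_of_mem (mem_univ i), card_univ, Fintype.card_fin, smul_eq_mul]

/-! ### Combining both steps and choosing the parameters. -/

/-- The combination of the absorbing family and the greedy almost perfect tiling. -/
theorem tiled_univ_of_parameters (E : Finset (Fin 3 → V)) [Nonempty V] {γ l : ℝ} (hγ : 0 < γ)
    (hdeg : ∀ i a, (5 / 9 + γ) * (Fintype.card V : ℝ) ^ 2 ≤ #(link E (fun _ => univ) i a))
    {m₀ t : ℕ} (hm₀ : 1 ≤ m₀) (hl : 1 ≤ l) (hlm : 8 * l ≤ m₀)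
    (ht : 729 * (3 + 12 * t) ≤ Fintype.card V) (hmt : m₀ ≤ t)
    (htγ : 8 * t ≤ γ * Fintype.card V)
    (habs : (399 / 400) ^ t * (Fintype.card V : ℝ) ^ 3 < (1 / 2) ^ m₀)
    (hlarge : 3 * Fintype.card V * Real.exp (68 * l ^ 2 / m₀) < Real.exp (l * (γ / 2))) :
    Tiled E fun _ => univ := by
  set n := Fintype.card V with hn
  obtain ⟨A, hA, hAcard, hdef⟩ := exists_absorbing E (fun i a =>
    (mul_le_mul_of_nonneg_right (by linarith) (by positivity)).trans (hdeg i a)) t ht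
  set U : Fin 3 → Finset V := fun i => A.biUnion fun p => verts p i with hU
  have hUcard : ∀ i, #(U i) = 2 * t := fun i => by rw [← hAcard]; exact hA.card_biUnion i
  obtain ⟨R', hR'sub, hR'card, htile⟩ := exists_tiled_of_degree E (γ := γ / 2) hl (N := n - 2 * t)
    hm₀ hlm (by omega) (fun i => univ \ U i)
    (fun i => by rw [card_sdiff_of_subset (subset_univ _), hUcard, card_univ]) (fun i a => by
      -- Removing 2t vertices per class costs at most 4tn ≤ γn²/2, half of the surplus.
      have h1 : ((_ : ℕ) : ℝ) ≤ _ := Nat.cast_le.2 (card_link_univ_le E U (fun i => (hUcard i).le) i a)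
      push_cast at h1
      have h2 := hdeg i a
      have h3 : ((n - 2 * t : ℕ) : ℝ) ≤ n := by exact_mod_cast Nat.sub_le _ _
      have h4 : ((n - 2 * t : ℕ) : ℝ) ^ 2 ≤ (n : ℝ) ^ 2 := pow_le_pow_left₀ (Nat.cast_nonneg _) h3 2
      have h5 : (5 / 9 + γ / 2) * ((n - 2 * t : ℕ) : ℝ) ^ 2 ≤ (5 / 9 + γ / 2) * (n : ℝ) ^ 2 :=
        mul_le_mul_of_nonneg_left h4 (by positivity)
      have h6 : 8 * t * (n : ℝ) ≤ γ * n * n :=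
        mul_le_mul_of_nonneg_right htγ (Nat.cast_nonneg _)
      nlinarith) hlarge
  have habsorb := IsAbsorbingFamily.tiled_union m₀ hA
    (le_card_absorbers (hdef.trans_lt habs)) R' hR'card
    (fun i => disjoint_left.2 fun x hx => (mem_sdiff.1 (hR'sub i hx)).2)
  convert htile.union habsorb (fun i => ?_) using 2 with i
  · ext x
    simp only [mem_univ, mem_union, mem_sdiff, true_and, true_iff]
    tauto
  · rw [disjoint_left]
    intro x hx
    simp only [mem_sdiff, mem_univ, true_and] at hx
    rw [mem_union, not_or]
    exact ⟨hx.2, hx.1⟩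

theorem tiled_univ (E : Finset (Fin 3 → V)) {γ : ℝ} (hγ : 0 < γ)
    (hdeg : ∀ i a, (5 / 9 + γ) * (Fintype.card V : ℝ) ^ 2 ≤ #(link E (fun _ => univ) i a))
    (hn : (10 : ℝ) ^ 22 * γ ^ (-12 : ℤ) < Fintype.card V) : Tiled E fun _ => univ := by
  set n := Fintype.card V with hndef
  have hnpos : (0 : ℝ) < n := lt_trans (by positivity) hn
  have : Nonempty V := Fintype.card_pos_iff.1 (by exact_mod_cast hnpos)
  have hγ1 : γ ≤ 4 / 9 := by
    have h1 := hdeg 0 (Classical.arbitrary V)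
    have h2 : ((_ : ℕ) : ℝ) ≤ _ := Nat.cast_le.2 (card_link_le (E := E) (R := fun _ => univ)
      (m := n) (fun _ => card_le_univ _) 0 (Classical.arbitrary V))
    push_cast at h2
    have h3 : (5 / 9 + γ) * (n : ℝ) ^ 2 ≤ 1 * (n : ℝ) ^ 2 := by linarith
    have := le_of_mul_le_mul_right h3 (by positivity)
    linarith
  set s := Real.sqrt n with hs
  have hs0 : 0 < s := Real.sqrt_pos.2 hnpos
  have hsn : s ^ 2 = n := Real.sq_sqrt hnpos.le
  -- Below this bound is used only through √n · γ² ≥ 10¹¹, so the exponent 12 leaves slack: 4 would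
  -- do here.
  have hsγ6 : (10 : ℝ) ^ 11 ≤ s * γ ^ 6 := by
    refine (sq_le_sq₀ (by positivity) (by positivity)).1 ?_
    have h1 : (10 : ℝ) ^ 22 < n * γ ^ 12 := by
      rw [zpow_neg, ← div_eq_mul_inv, div_lt_iff₀ (by positivity)] at hn
      exact_mod_cast hn
    calc ((10 : ℝ) ^ 11) ^ 2 = 10 ^ 22 := by norm_num
      _ ≤ n * γ ^ 12 := h1.le
      _ = _ := by rw [← hsn]; ring
  have hsγ2 : (10 : ℝ) ^ 11 ≤ s * γ ^ 2 := hsγ6.trans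
    (mul_le_mul_of_nonneg_left (pow_le_pow_of_le_one hγ.le (by linarith) (by norm_num)) hs0.le)
  have hsγ : (10 : ℝ) ^ 11 ≤ s * γ := hsγ2.trans
    (mul_le_mul_of_nonneg_left (pow_le_of_le_one hγ.le (by linarith) (by norm_num)) hs0.le)
  have hs11 : (10 : ℝ) ^ 11 ≤ s := by nlinarith
  set m₀ := ⌊γ * n / 10 ^ 7⌋₊ with hm₀
  have hγn : (10 : ℝ) ^ 22 ≤ γ * n := by
    rw [← hsn]
    calc (10 : ℝ) ^ 22 = 10 ^ 11 * 10 ^ 11 := by norm_num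
      _ ≤ (s * γ) * s := mul_le_mul hsγ hs11 (by positivity) (by positivity)
      _ = _ := by ring
  have hm_le : (m₀ : ℝ) ≤ γ * n / 10 ^ 7 := Nat.floor_le (by positivity)
  have hm_ge : γ * n / (2 * 10 ^ 7) ≤ m₀ := by
    have := Nat.lt_floor_add_one (γ * n / 10 ^ 7)
    rw [← hm₀] at this
    have h2 : γ * n / (2 * 10 ^ 7) = γ * n / 10 ^ 7 / 2 := by ring
    have h3 : (2 : ℝ) ≤ γ * n / 10 ^ 7 := by rw [le_div_iff₀ (by positivity)]; linarith
    linarith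
  have hmpos : (0 : ℝ) < m₀ := lt_of_lt_of_le (by positivity) hm_ge
  have hγnn : γ * n ≤ 4 / 9 * n := mul_le_mul_of_nonneg_right hγ1 hnpos.le
  -- With l = √n and m₀ of order γn, the accumulated error 68l²/m₀ is O(1/γ) while the gain lγ/2 is
  -- of order γ√n. The factor 1000 makes (399/400)^1000 ≤ 1/4, so absorption reduces to n³ < 2^m₀.
  refine tiled_univ_of_parameters E (l := s) (m₀ := m₀) (t := 1000 * m₀) hγ hdeg
    (by exact_mod_cast hmpos) (by linarith) ?_ ?_ (by omega) ?_ ?_ ?_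
  · refine le_trans ?_ hm_ge
    rw [le_div_iff₀ (by positivity), ← hsn]
    have := mul_le_mul_of_nonneg_right hsγ hs0.le
    linarith
  · have : (729 : ℝ) * (3 + 12 * (1000 * m₀)) ≤ n := by
      have h2 : 1000 * (m₀ : ℝ) ≤ γ * n / 10 ^ 4 := by
        calc 1000 * (m₀ : ℝ) ≤ 1000 * (γ * n / 10 ^ 7) := by linarith
          _ = _ := by ring
      linarith
    exact_mod_cast this
  · push_cast
    linarith
  · have hpow : ((399 / 400 : ℝ) ^ (1000 * m₀)) ≤ (1 / 4) ^ m₀ := by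
      rw [pow_mul]
      refine pow_le_pow_left₀ (by positivity) ?_ _
      calc (399 / 400 : ℝ) ^ 1000 = ((399 / 400) ^ 100) ^ 10 := by rw [← pow_mul]
        _ ≤ (4 / 5) ^ 10 := pow_le_pow_left₀ (by positivity) (by norm_num) 10
        _ ≤ 1 / 4 := by norm_num
    have hexp : (n : ℝ) ^ 3 < 2 ^ m₀ := by
      have h1 : Real.exp ((m₀ : ℝ) / 2) ≤ 2 ^ m₀ := by
        have h2 : Real.exp (1 / 2) ≤ 2 := by
          have := Real.exp_one_lt_d9
          have h3 : Real.exp (1 / 2) ^ 2 = Real.exp 1 := by rw [← Real.exp_nat_mul]; norm_num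
          nlinarith [Real.exp_pos (1 / 2)]
        calc Real.exp ((m₀ : ℝ) / 2) = Real.exp (1 / 2) ^ m₀ := by
              rw [← Real.exp_nat_mul]; ring_nf
          _ ≤ _ := pow_le_pow_left₀ (Real.exp_pos _).le h2 _
      refine lt_of_lt_of_le ?_ h1
      have hx : γ * n / (4 * 10 ^ 7) ≤ (m₀ : ℝ) / 2 := by
        calc γ * n / (4 * 10 ^ 7) = γ * n / (2 * 10 ^ 7) / 2 := by ring
          _ ≤ _ := by linarith
      have h2 := Real.pow_div_factorial_le_exp _ (show 0 ≤ γ * n / (4 * 10 ^ 7) by positivity) 6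
      refine lt_of_lt_of_le ?_ (h2.trans (Real.exp_le_exp.2 hx))
      rw [lt_div_iff₀ (by positivity), div_pow, lt_div_iff₀ (by positivity)]
      have h3 : ((10 : ℝ) ^ 22) ^ 3 ≤ (n * γ ^ 2) ^ 3 := by
        refine pow_le_pow_left₀ (by positivity) ?_ 3
        calc (10 : ℝ) ^ 22 = 10 ^ 11 * 10 ^ 11 := by norm_num
          _ ≤ (s * γ) * (s * γ) := mul_le_mul hsγ hsγ (by positivity) (by positivity)
          _ = n * γ ^ 2 := by rw [← hsn]; ring
      have h4 := mul_le_mul_of_nonneg_left h3 (show 0 ≤ (n : ℝ) ^ 3 by positivity)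
      have h5 : (0 : ℝ) < (n : ℝ) ^ 3 := by positivity
      calc (n : ℝ) ^ 3 * (Nat.factorial 6 : ℕ) * (4 * 10 ^ 7) ^ 6
          = (n : ℝ) ^ 3 * (720 * (4 * 10 ^ 7) ^ 6) := by norm_num [Nat.factorial]; ring
        _ < (n : ℝ) ^ 3 * ((10 : ℝ) ^ 22) ^ 3 := mul_lt_mul_of_pos_left (by norm_num) h5
        _ ≤ _ := h4
        _ = _ := by ring
    calc _ ≤ (1 / 4 : ℝ) ^ m₀ * (n : ℝ) ^ 3 :=
          mul_le_mul_of_nonneg_right hpow (by positivity)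
      _ < (1 / 4 : ℝ) ^ m₀ * 2 ^ m₀ := mul_lt_mul_of_pos_left hexp (by positivity)
      _ = (1 / 2) ^ m₀ := by rw [← mul_pow]; norm_num
  · have h1 : 68 * s ^ 2 / m₀ ≤ s * γ / 4 := by
      rw [div_le_iff₀ hmpos]
      refine le_trans ?_ (mul_le_mul_of_nonneg_left hm_ge (by positivity))
      rw [← hsn]
      have := mul_le_mul_of_nonneg_right hsγ2 (sq_nonneg s)
      calc 68 * s ^ 2 ≤ 10 ^ 11 * s ^ 2 / (8 * 10 ^ 7) := by nlinarith [sq_nonneg s]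
        _ ≤ (s * γ ^ 2 * s ^ 2) / (8 * 10 ^ 7) := by gcongr
        _ = _ := by ring
    have h2 : 3 * (n : ℝ) < Real.exp (s * γ / 4) := by
      have h3 := Real.pow_div_factorial_le_exp _ (show 0 ≤ s * γ / 4 by positivity) 4
      refine lt_of_lt_of_le ?_ h3
      rw [lt_div_iff₀ (by positivity), div_pow, lt_div_iff₀ (by positivity)]
      have h4 : ((10 : ℝ) ^ 11) ^ 2 ≤ (s * γ ^ 2) ^ 2 := pow_le_pow_left₀ (by positivity) hsγ2 2
      have h5 := mul_le_mul_of_nonneg_left h4 hnpos.le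
      calc 3 * (n : ℝ) * (Nat.factorial 4 : ℕ) * 4 ^ 4 = n * 18432 := by
            norm_num [Nat.factorial]; ring
        _ < n * ((10 : ℝ) ^ 11) ^ 2 := mul_lt_mul_of_pos_left (by norm_num) hnpos
        _ ≤ _ := h5
        _ = _ := by rw [← hsn]; ring
    calc 3 * (n : ℝ) * Real.exp (68 * s ^ 2 / m₀) ≤ 3 * n * Real.exp (s * γ / 4) :=
          mul_le_mul_of_nonneg_left (Real.exp_le_exp.2 h1) (by positivity)
      _ < Real.exp (s * γ / 4) * Real.exp (s * γ / 4) :=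
          mul_lt_mul_of_pos_right h2 (Real.exp_pos _)
      _ = _ := by rw [← Real.exp_add]; ring_nf

end

end Tuples

/-! ### Transfer between tuples and the hypergraph. -/

/-- A tiling of all tuple vertices yields a perfect matching of the hypergraph. -/
theorem exists_perfectMatching_of_tiled {α V : Type*} [Fintype V] [DecidableEq V]
    {H : Hypergraph α} {P : Fin 3 → Set α} (hP : H.IsKPartition P) (φ : ∀ i, V ≃ P i)
    {E : Finset (Fin 3 → V)}
    (hE : ∀ f ∈ E, Set.range (fun i => (φ i (f i) : α)) ∈ H.edgeSet)
    (hT : Tiled E fun _ => univ) : ∃ M : Set (Set α), H.IsPerfectMatching M := by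
  obtain ⟨M, hME, hM, hcov⟩ := hT
  refine ⟨(fun f : Fin 3 → V => Set.range fun i => (φ i (f i) : α)) '' (M : Set (Fin 3 → V)),
    ⟨?_, ?_⟩, ?_⟩
  · rintro _ ⟨f, hf, rfl⟩
    exact hE f (hME hf)
  · rintro _ ⟨f, hf, rfl⟩ _ ⟨g, hg, rfl⟩ hfg
    have hne : f ≠ g := fun h => hfg (by rw [h])
    rw [Set.disjoint_left]
    rintro _ ⟨i, rfl⟩ ⟨j, hj⟩
    simp only at hj
    by_cases hij : i = j
    · subst hij
      exact hM f hf g hg hne i ((φ i).injective (Subtype.ext hj)).symm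
    · exact Set.disjoint_left.1 (hP.disjoint i j hij) (φ i (f i)).2 (hj ▸ (φ j (g j)).2)
  · rw [← hP.iUnion_eq]
    ext x
    simp only [Set.mem_sUnion, Set.mem_image, Set.mem_iUnion]
    constructor
    · rintro ⟨_, ⟨f, -, rfl⟩, i, rfl⟩
      exact ⟨i, (φ i (f i)).2⟩
    · rintro ⟨i, hi⟩
      have : (φ i).symm ⟨x, hi⟩ ∈ M.image fun f => f i := by rw [hcov]; exact mem_univ _
      obtain ⟨f, hf, hfx⟩ := mem_image.1 this
      refine ⟨_, ⟨f, hf, rfl⟩, i, ?_⟩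
      simp [hfx]

/-- Every edge of a 3-partite 3-graph is the range of a tuple. -/
theorem exists_tuple_of_mem_edgeSet {α V : Type*} {H : Hypergraph α} {P : Fin 3 → Set α}
    (hP : H.IsKPartition P) (φ : ∀ i, V ≃ P i) {e : Set α} (he : e ∈ H.edgeSet) :
    ∃ f : Fin 3 → V, Set.range (fun i => (φ i (f i) : α)) = e := by
  have h : ∀ i, ∃ x, e ∩ P i = {x} := fun i => Set.encard_eq_one.1 (hP.encard_edge_inter e he i)
  choose x hx using h
  have hmem : ∀ i, x i ∈ e ∩ P i := fun i => by rw [hx]; rfl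
  refine ⟨fun i => (φ i).symm ⟨x i, (hmem i).2⟩, ?_⟩
  ext y
  simp only [Equiv.apply_symm_apply, Set.mem_range]
  constructor
  · rintro ⟨i, rfl⟩; exact (hmem i).1
  · intro hy
    have hyV := H.subset_vertexSet_of_mem_edgeSet' he hy
    rw [← hP.iUnion_eq] at hyV
    obtain ⟨i, hi⟩ := Set.mem_iUnion.1 hyV
    have : y ∈ e ∩ P i := ⟨hy, hi⟩
    rw [hx] at this
    exact ⟨i, this.symm⟩

/-- A singleton is legal, so its degree bounds the infimum from above. A set S counted there has two
elements and avoids v, hence is an edge through v with v removed, and that edge comes from a tuple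
in the link. -/
theorem minLegalDegree_le_card_link {α V : Type*} [Fintype V] [DecidableEq V]
    {H : Hypergraph α} {P : Fin 3 → Set α} (hH : H.IsKGraph 3) (hP : H.IsKPartition P)
    (φ : ∀ i, V ≃ P i) {E : Finset (Fin 3 → V)}
    (hE : ∀ f, f ∈ E ↔ Set.range (fun i => (φ i (f i) : α)) ∈ H.edgeSet) (i : Fin 3) (a : V) :
    H.minLegalDegree P 1 ≤ #(link E (fun _ => univ) i a) := by
  set v : α := (φ i a : α) with hv
  have hvP : v ∈ P i := (φ i a).2
  have hlegal : H.IsLegal P 1 {v} := by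
    refine ⟨?_, by simp, fun j => ?_⟩
    · rw [Set.singleton_subset_iff, ← hP.iUnion_eq]
      exact Set.mem_iUnion.2 ⟨i, hvP⟩
    · exact (Set.encard_le_encard Set.inter_subset_left).trans (by simp)
  have hle : H.minLegalDegree P 1 ≤ H.setDegree 3 {v} := Nat.sInf_le ⟨_, hlegal, rfl⟩
  refine hle.trans ?_
  rw [Hypergraph.setDegree, ← Set.ncard_coe_finset]
  have hsub : {S : Set α | S ⊆ H.vertexSet ∧ S.encard + ({v} : Set α).encard = (3 : ℕ) ∧
      S ∪ {v} ∈ H.edgeSet} ⊆ (fun f : Fin 3 → V => Set.range (fun i => (φ i (f i) : α)) \ {v}) ''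
        (link E (fun _ => univ) i a : Set (Fin 3 → V)) := by
    rintro S ⟨-, hcard, hS⟩
    obtain ⟨f, hf⟩ := exists_tuple_of_mem_edgeSet hP φ hS
    have hvS : v ∉ S := by
      intro hv
      have h3 := hH.encard_edge _ hS
      rw [Set.union_eq_self_of_subset_right (Set.singleton_subset_iff.2 hv)] at h3
      rw [h3, Set.encard_singleton] at hcard
      exact absurd hcard (by decide)
    refine ⟨f, ?_, ?_⟩
    · refine mem_link.2 ⟨(hE f).2 (hf ▸ hS), ?_, fun _ _ => mem_univ _⟩
      have hvf : v ∈ Set.range (fun i => (φ i (f i) : α)) := by rw [hf]; simp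
      obtain ⟨j, hj⟩ := hvf
      have hji : j = i := by
        by_contra hne
        exact Set.disjoint_left.1 (hP.disjoint j i hne) (φ j (f j)).2 (by
          simp only at hj; rw [hj]; exact hvP)
      subst hji
      exact (φ j).injective (Subtype.ext hj)
    · simp only [hf]
      ext x
      simp only [Set.mem_sdiff, Set.mem_union, Set.mem_singleton_iff]
      constructor
      · tauto
      · intro hx
        exact ⟨Or.inl hx, fun h => hvS (h ▸ hx)⟩
  exact (Set.ncard_le_ncard hsub (Set.toFinite _)).trans (Set.ncard_image_le (Set.toFinite _))

end TripartiteMatching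

open TripartiteMatching in
theorem mainTheorem3 :
    ∃ c : ℝ, 0 < c ∧ ∀ γ : ℝ, 0 < γ →
      ∀ (α : Type*) (H : Hypergraph α) (P : Fin 3 → Set α) (n : ℕ),
        H.IsKGraph 3 → H.IsKPartition P → (∀ i, (P i).encard = n) →
        (n : ℝ) > c * γ ^ (-12 : ℤ) →
        (H.minLegalDegree P 1 : ℝ) ≥ (5 / 9 + γ) * (n : ℝ) ^ 2 →
        ∃ M : Set (Set α), H.IsPerfectMatching M := by
  classical
  refine ⟨10 ^ 22, by norm_num, fun γ hγ α H P n hH hP hcard hn hdeg => ?_⟩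
  have hφ : ∀ i, Nonempty (Fin n ≃ P i) := fun i => by
    have hfin : (P i).Finite := Set.finite_of_encard_eq_coe (hcard i)
    have : Finite (P i) := hfin
    have h2 : Nat.card (P i) = n := by
      rw [Nat.card_coe_set_eq, Set.ncard, hcard i]; rfl
    exact ⟨(Finite.equivFinOfCardEq h2).symm⟩
  have φ : ∀ i, Fin n ≃ P i := fun i => (hφ i).some
  set E : Finset (Fin 3 → Fin n) := Finset.univ.filter fun f =>
    Set.range (fun i => (φ i (f i) : α)) ∈ H.edgeSet with hE
  have hEmem : ∀ f, f ∈ E ↔ Set.range (fun i => (φ i (f i) : α)) ∈ H.edgeSet := by simp [hE]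
  refine exists_perfectMatching_of_tiled hP φ (fun f hf => (hEmem f).1 hf)
    (tiled_univ E hγ (fun i a => ?_) (by simpa using hn))
  rw [Fintype.card_fin]
  refine hdeg.le.trans ?_
  exact_mod_cast minLegalDegree_le_card_link hH hP φ hEmem i a
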